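/- Theorem. Notation. Let $n\ge 3$, let $S=(p_1,\dots,p_m)$ be a stream with $p_i\in[n]$, and let $q_0<q_1<\dots<q_R\le m$ be times in $S$ (the round boundaries). For $r\in[R]$ let $f^{(r)}_j=\#\{t: q_{r-1}<t\le q_r,\ p_t=j\}$. Fix $w$ and a map $h:\{0,1\}^w\to\{0,1\}^n$ whose $n$ output bits, on a uniformly random seed, are uniform and four-wise independent. In round $r$ the algorithm Sieve uses $N=2(2k+1)s+1$ seeds of $w$ bits (its *chunk* of $Nw$ random bits). The first seed gives hash bits $B_{r,1},\dots,B_{r,n}$ through $h$, which split $[n]$ into two sides. Each other seed gives through $h$ a sign vector $\sigma\in\{-1,1\}^n$. On each side $b\in\{0,1\}$ an AMS sketch with its own $(2k+1)s$ sign vectors estimates the second moment of the round's updates to the items with $B_{r,j}=b$: it is the median of $2k+1$ averages of $s$ values $\bigl(\sum_{j:B_{r,j}=b}\sigma_jf^{(r)}_j\bigr)^2$. Sieve outputs the side $b_r$ with the larger estimate ($0$ in a tie). Let $N_j=\#\{r\in[R]: B_{r,j}=b_r\}$. Selector returns some $j^*\in[n]$ that maximizes $N_j$; its tie-breaking is an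 arbitrary function of $(B_{r,j})_{r,j}$ and $(b_r)_r$. The auxiliary algorithm of an item $j$ outputs $1$ if $N_j>3R/4$ and $0$ otherwise. For $C>0$, an item $H$ is everywhere heavy for $q$ if $(f^{(r)}_H)^2\ge C^2\sum_{j\ne H}(f^{(r)}_j)^2$ for all $r\in[R]$. Nisan's generator has as its seed a block $x\in\{0,1\}^v$ and $d$ hash functions $h_i(x)=A_ix+b_i$ over $\mathbb F_2$, where $A_i$ is a $v\times v$ Hankel matrix (entry $(u,l)$ depends only on $u+l$) and $b_i\in\{0,1\}^v$; each $h_i$ is described by $3v$ bits, so the seed has $v+3vd$ bits. Its $2^d$ output blocks are given by $G_0(x)=x$ and $G_{i}(x;h_1,\dots,h_{i})=G_{i-1}(x;h_1,\dots,h_{i-1})\,G_{i-1}(h_{i}(x);h_1,\dots,h_{i-1})$. If $Nw\le v$ and $R\le 2^d$, Sieve is run with Nisan's generator by letting the chunk of round $r$ be the first $Nw$ bits of the $r$-th output block. Statement. (a) There is a constant $c$ such that for every $n\ge3$ a four-wise independent $h$ as above exists with $w\le c\log n$. (b) There are absolute constants $C>0$, $\rho_0>0$ and $s_0$ such that for all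 constants $a,k\in\mathbb N$, $c,\rho\in\mathbb R$ and $s\ge s_0$ there is a constant $K$ for which the following holds for all $n\ge3$, all $R\le\rho\log n$, all $w\le c\log n$ and every four-wise independent $h:\{0,1\}^w\to\{0,1\}^n$. There are $v\ge Nw$ and $d$ with $2^d\ge R$ such that the seed of Nisan's generator has at most $K\log n\log\log n$ bits and: 1. For every $S$, every $q$ and every item $j\in[n]$, the probability that the auxiliary algorithm of $j$ outputs $1$ when its bits come from Nisan's generator on a uniformly random seed differs by at most $1/n^2$ from the probability with uniformly random bits (independent rounds). 2. For every tie-breaking rule of Selector there is a one-pass algorithm that stores the seed and, between two input symbols, at most $K\log n$ further bits, and that, reading any stream $S$ of length $m\le n^a$ with a mark at each of the times $q_0,\dots,q_R$, outputs for every seed exactly what Sieve followed by Selector outputs with the bits of Nisan's generator on that seed. 3. If moreover $R\ge\rho_0\log n$, then for every tie-breaking rule, every $S$ and $q$ and every item $H$ that is everywhere heavy for $q$ (with the constant $C$), the probability that Selector returns $H$ when the bits come from Nisan's generator on a uniformly random seed differs by at most $1/n$ from the probability when all rounds use independent uniformly random bits. -/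

import Mathlib

namespace CountSieve

/-- Probability of the event `p` under the uniform distribution on a finite type `α`. -/
noncomputable def unifPr {α : Type*} (p : α → Prop) : ℝ :=
  (Nat.card {x : α // p x} : ℝ) / (Nat.card α : ℝ)

/-- `h` expands a uniformly random `w`-bit string into `n` uniform bits that are four-wise
independent: on any at most four coordinates every pattern is equally likely. -/
def IsFourWise {n w : ℕ} (h : (Fin w → Bool) → Fin n → Bool) : Prop :=
  ∀ I : Finset (Fin n), I.card ≤ 4 → ∀ b : Fin n → Bool,
    unifPr (fun x : Fin w → Bool => ∀ i ∈ I, h x i = b i) = (1 / 2 : ℝ) ^ I.card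

/-! ### Streams -/

/-- `S^{t₁:t₂}`, the updates `p_{t₁+1}, …, p_{t₂}`. -/
def interval {n : ℕ} (S : List (Fin n)) (t₁ t₂ : ℕ) : List (Fin n) :=
  (S.take t₂).drop t₁

/-- `q₀ < q₁ < ⋯ < q_R` are times in the stream `S`. -/
def IsRoundTimes {n R : ℕ} (S : List (Fin n)) (q : Fin (R + 1) → ℕ) : Prop :=
  StrictMono q ∧ q (Fin.last R) ≤ S.length

/-- The substream of round `r`. -/
def roundStream {n R : ℕ} (S : List (Fin n)) (q : Fin (R + 1) → ℕ) (r : Fin R) : List (Fin n) :=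
  interval S (q r.castSucc) (q r.succ)

/-- In every round the squared frequency of `H` is at least `C²` times the sum of the squared
frequencies of all the other items. -/
def EverywhereHeavy {n R : ℕ} (C : ℝ) (S : List (Fin n)) (q : Fin (R + 1) → ℕ) (H : Fin n) :
    Prop :=
  ∀ r : Fin R, C ^ 2 * ∑ j ∈ Finset.univ.erase H, ((roundStream S q r).count j : ℝ) ^ 2 ≤
    ((roundStream S q r).count H : ℝ) ^ 2

/-! ### The AMS sketch -/

/-- The Rademacher variable of a bit. -/
def sgn (b : Bool) : ℝ := if b then 1 else -1

/-- Median of an odd number of reals. -/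
noncomputable def median {k : ℕ} (x : Fin (2 * k + 1) → ℝ) : ℝ :=
  x (Tuple.sort x ⟨k, by omega⟩)

/-- The AMS estimate of the second moment of the stream `T`: the median of `2k+1` averages of `s`
squares of the linear sums `∑ⱼ σⱼ fⱼ`, each sum having its own sign vector. -/
noncomputable def amsEstimate {n s k : ℕ} (σ : Fin (2 * k + 1) → Fin s → Fin n → Bool)
    (T : List (Fin n)) : ℝ :=
  median fun g => (∑ l : Fin s, (∑ j : Fin n, sgn (σ g l j) * (T.count j : ℝ)) ^ 2) / (s : ℝ)

/-! ### Sieve and Selector -/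

/-- The number of seeds used in one round: one for the hash bits `B_{r,1}, …, B_{r,n}`, and one for
each of the `(2k+1) s` sign vectors of each of the two AMS sketches. -/
def numSeeds (s k : ℕ) : ℕ := 2 * ((2 * k + 1) * s) + 1

/-- The number of random bits used in one round, with seeds of `w` bits. -/
def chunkBits (s k w : ℕ) : ℕ := numSeeds s k * w

/-- The random bits of one round. -/
abbrev Chunk (s k w : ℕ) : Type := Fin (chunkBits s k w) → Bool

/-- The `i`-th seed in a chunk. -/
def Chunk.seed {s k w : ℕ} (y : Chunk s k w) (i : Fin (numSeeds s k)) : Fin w → Bool :=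
  fun l => y (finProdFinEquiv (i, l))

/-- The hash bits `B_{r,1}, …, B_{r,n}` of a round. -/
def hashBits {n s k w : ℕ} (h : (Fin w → Bool) → Fin n → Bool) (y : Chunk s k w) :
    Fin n → Bool :=
  h (y.seed (0 : Fin (2 * ((2 * k + 1) * s) + 1)))

/-- The sign vectors of the AMS sketch run on side `b` in a round. -/
def signBits {n s k w : ℕ} (h : (Fin w → Bool) → Fin n → Bool) (y : Chunk s k w) (b : Fin 2) :
    Fin (2 * k + 1) → Fin s → Fin n → Bool :=
  fun g l => h (y.seed (Fin.succ (finProdFinEquiv (b, finProdFinEquiv (g, l)))))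

/-- The pair of AMS sketches of a round, at the end of the round. The substream `T` is split by the
hash bits; the result is the side with the larger estimate (side `0`, i.e. `false`, in a tie). -/
noncomputable def pairBit {n s k w : ℕ} (h : (Fin w → Bool) → Fin n → Bool)
    (T : List (Fin n)) (y : Chunk s k w) : Bool :=
  decide (amsEstimate (signBits h y 0) (T.filter fun j => hashBits h y j = false) <
    amsEstimate (signBits h y 1) (T.filter fun j => hashBits h y j = true))

/-- Sieve: the winning bits `b₁, …, b_R`, where round `r` uses the random bits `y r`. -/
noncomputable def sieve {n s k w R : ℕ} (h : (Fin w → Bool) → Fin n → Bool)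
    (S : List (Fin n)) (q : Fin (R + 1) → ℕ) (y : Fin R → Chunk s k w) : Fin R → Bool :=
  fun r => pairBit h (roundStream S q r) (y r)

/-- `#{r ∈ [R] : B_{r,j} = b_r}`. -/
def wins {n R : ℕ} (B : Fin R → Fin n → Bool) (b : Fin R → Bool) (j : Fin n) : ℕ :=
  (Finset.univ.filter fun r : Fin R => B r j = b r).card

/-- Selector: a rule that returns some item with the largest number of wins (ties are broken
arbitrarily). -/
def IsSelector {n R : ℕ} (sel : (Fin R → Fin n → Bool) → (Fin R → Bool) → Fin n) : Prop :=
  ∀ B b j, wins B b j ≤ wins B b (sel B b)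

/-- `N_j`, the number of rounds that item `j` wins when the rounds use the random bits `y`. -/
noncomputable def itemWins {n s k w R : ℕ} (h : (Fin w → Bool) → Fin n → Bool)
    (S : List (Fin n)) (q : Fin (R + 1) → ℕ) (y : Fin R → Chunk s k w) (j : Fin n) : ℕ :=
  wins (fun r => hashBits h (y r)) (sieve h S q y) j

/-- The auxiliary per-item algorithm: it outputs `1` iff `N_j > 3R/4`. -/
noncomputable def auxBit {n s k w R : ℕ} (h : (Fin w → Bool) → Fin n → Bool)
    (S : List (Fin n)) (q : Fin (R + 1) → ℕ) (j : Fin n) (y : Fin R → Chunk s k w) : Bool :=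
  decide (3 * (R : ℝ) / 4 < (itemWins h S q y j : ℝ))

/-- The output of Selector on the bits of Sieve, when the rounds use the random bits `y`. -/
noncomputable def sieveSelector {n s k w R : ℕ} (h : (Fin w → Bool) → Fin n → Bool)
    (sel : (Fin R → Fin n → Bool) → (Fin R → Bool) → Fin n)
    (S : List (Fin n)) (q : Fin (R + 1) → ℕ) (y : Fin R → Chunk s k w) : Fin n :=
  sel (fun r => hashBits h (y r)) (sieve h S q y)

/-! ### Nisan's generator -/

/-- Description of an affine convolution hash function on `v`-bit strings. -/
abbrev HashSeed (v : ℕ) : Type := (Fin (2 * v) → Bool) × (Fin v → Bool)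

/-- `x ↦ A x + b` over the two-element field, where `A i l = a (i + l)`; over a random `(a, b)`
this is a pairwise independent family of functions from `{0,1}^v` to itself. -/
def convHash {v : ℕ} (ab : HashSeed v) (x : Fin v → Bool) : Fin v → Bool := fun i =>
  decide ((∑ l : Fin v, (if ab.1 ⟨i + l, by omega⟩ && x l then (1 : ZMod 2) else 0)) +
    (if ab.2 i then (1 : ZMod 2) else 0) = 1)

/-- A seed of Nisan's generator: an initial block of `v` bits and `d` hash functions. -/
abbrev NisanSeed (v d : ℕ) : Type := (Fin v → Bool) × (Fin d → HashSeed v)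

/-- The number of bits in a seed. -/
def nisanSeedLength (v d : ℕ) : ℕ := v + d * (3 * v)

theorem card_nisanSeed (v d : ℕ) : Fintype.card (NisanSeed v d) = 2 ^ nisanSeedLength v d := by
  simp only [Fintype.card_prod, Fintype.card_fun, Fintype.card_bool, Fintype.card_fin,
    nisanSeedLength, ← pow_add, ← pow_mul]
  congr 1
  ring

/-- Nisan's generator: `G₀(x) = x` and
`G_{d+1}(x; h₁, …, h_{d+1}) = G_d(x; h₁, …, h_d) G_d(h_{d+1}(x); h₁, …, h_d)`;
this is its output block number `i < 2^d`, counted from `0`. -/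
def nisanBlock {v : ℕ} : (d : ℕ) → (Fin d → HashSeed v) → (Fin v → Bool) → ℕ → (Fin v → Bool)
  | 0, _, x, _ => x
  | d + 1, hs, x, i =>
    if i < 2 ^ d then nisanBlock d (fun e => hs e.castSucc) x i
    else nisanBlock d (fun e => hs e.castSucc) (convHash (hs (Fin.last d)) x) (i - 2 ^ d)

/-- The random bits of `R` rounds taken from Nisan's generator: round `r` reads the first
`chunkBits s k w` bits of the `r`-th output block. -/
def nisanChunks {s k w v : ℕ} (hv : chunkBits s k w ≤ v) (R d : ℕ) (z : NisanSeed v d) :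
    Fin R → Chunk s k w :=
  fun r l => nisanBlock d z.2 z.1 (r : ℕ) (Fin.castLE hv l)

/-! ### One-pass algorithms -/

/-- The input of Sieve as read in one pass: the updates of `S` in order, interleaved with a mark
`none` at each of the times `q₀, …, q_R`. -/
noncomputable def markedStream {n R : ℕ} (S : List (Fin n)) (q : Fin (R + 1) → ℕ) :
    List (Option (Fin n)) :=
  open Classical in
  (List.range (S.length + 1)).flatMap fun t =>
    (if t ∈ Set.range q then [none] else []) ++ (S[t]?).toList.map some

/-- A one-pass algorithm on inputs over `In` that stores a random seed in `Seed`, which it may read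
at any time but not change, and between two input symbols keeps `work` further bits. -/
structure OnePass (Seed In Out : Type) where
  work : ℕ
  init : Seed → (Fin work → Bool)
  step : Seed → (Fin work → Bool) → In → (Fin work → Bool)
  output : Seed → (Fin work → Bool) → Out

/-- The output on input `l` with random seed `z`. -/
def OnePass.run {Seed In Out : Type} (A : OnePass Seed In Out) (z : Seed) (l : List In) : Out :=
  A.output z (l.foldl (A.step z) (A.init z))

end CountSieve

open CountSieve

/-!
Two facts carry the theorem: the auxiliary algorithm of an item is a read-once program with `R + 1`
states, so Nisan's generator fools it, and an everywhere heavy item is found as soon as all the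
auxiliary algorithms behave as expected.

*Short seeds.* A random polynomial of degree at most three over a field with `2 ^ m ≥ n` elements
has independent uniform values at any four points, by interpolation; a nonzero functional to `𝔽₂`
turns the values into bits (`exists_isFourWise`).

*Nisan's generator.* A random Hankel matrix maps a fixed nonzero vector to a uniform vector
(`hankel_surjective`), so the hash functions are pairwise independent, and by the second moment
`|Pr[x ∈ A, h x ∈ B] - Pr[A] Pr[B]|` is at most `2 ^ (-v / 2)` on average over `h`
(`expect_abs_mixing_le`). Hence each doubling of the number of blocks doubles the expected error of
the transition probabilities and adds `W ^ 2 * 2 ^ (-v / 2)` for `W` states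
(`expect_nisanTrans_sub_le`); working with expected errors makes an exceptional set of hash
functions unnecessary. For `v` a large multiple of `log n` the final error is at most `1 / n ^ 3`.

*Heavy items.* Let `H` be everywhere heavy. On either side of the split the signed sum of the
items other than `H` has second moment at most `f_H ^ 2 / C ^ 2`. If the wrong side wins a round,
then on one of the sides more than half of the `2 k + 1` averages of the squares of these sums are
at least `f_H ^ 2 / 4`, so Markov's inequality for the total of all the squares bounds the
probability by `1 / 64`, whatever `s ≥ 1` and `k` are (`expect_not_wins_le`). Any other item wins
with probability at most `1 / 2 + 1 / 64`. By Chernoff bounds over `R ≥ 40 log n` rounds, with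
probability close to one `H` is the only item that wins more than `3 R / 4` rounds, and a union bound
over the items transfers this to the bits of the generator (`abs_sieveSelector_sub_le`).

*Space.* In one pass it suffices to keep the number of marks, the signed sums of the current round,
which are integers of absolute value at most `n ^ a`, and the winning bits of the finished rounds
(`exists_onePass_sieveSelector`).
-/

namespace CountSieve

open Finset
open scoped BigOperators

/-! ### Averages over finite types -/

/-- The real indicator of a proposition. Decidability is classical, so that indicators of the same
proposition are syntactically equal. -/
noncomputable def ind (p : Prop) : ℝ :=
  open Classical in if p then 1 else 0

theorem ind_true {p : Prop} (h : p) : ind p = 1 := by simp [ind, h]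

theorem ind_false {p : Prop} (h : ¬ p) : ind p = 0 := by simp [ind, h]

theorem ind_nonneg (p : Prop) : 0 ≤ ind p := by unfold ind; split_ifs <;> norm_num

theorem ind_le_one (p : Prop) : ind p ≤ 1 := by unfold ind; split_ifs <;> norm_num

theorem ind_mono {p q : Prop} (h : p → q) : ind p ≤ ind q := by
  by_cases hp : p
  · rw [ind_true hp, ind_true (h hp)]
  · rw [ind_false hp]; exact ind_nonneg q

theorem ind_congr {p q : Prop} (h : p ↔ q) : ind p = ind q := by rw [propext h]

theorem ind_not (p : Prop) : ind (¬ p) = 1 - ind p := by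
  by_cases hp : p <;> simp [ind, hp]

theorem ind_or_le (p q : Prop) : ind (p ∨ q) ≤ ind p + ind q := by
  by_cases hp : p <;> by_cases hq : q <;> simp [ind, hp, hq]

theorem sum_ind_eq {Q : Type*} [Fintype Q] (a : Q) : ∑ q, ind (a = q) = 1 := by
  classical
  rw [Finset.sum_eq_single a]
  · exact ind_true rfl
  · intro b _ hb; exact ind_false (Ne.symm hb)
  · simp

/-- Splitting over the value of `a`. -/
theorem sum_ind_eq_mul {Q : Type*} [Fintype Q] (a : Q) (f : Q → ℝ) :
    ∑ q, ind (a = q) * f q = f a := by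
  classical
  rw [Finset.sum_eq_single a]
  · rw [ind_true rfl, one_mul]
  · intro b _ hb; rw [ind_false (Ne.symm hb), zero_mul]
  · simp

theorem unifPr_eq_expect {α : Type*} [Fintype α] (p : α → Prop) :
    unifPr p = 𝔼 x, ind (p x) := by
  classical
  rw [unifPr, Fintype.expect_eq_sum_div_card, Nat.card_eq_fintype_card, Nat.card_eq_fintype_card,
    Fintype.card_subtype]
  simp [ind]

theorem expect_mono {α : Type*} [Fintype α] {f g : α → ℝ} (h : ∀ x, f x ≤ g x) :
    𝔼 x, f x ≤ 𝔼 x, g x :=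
  Finset.expect_le_expect fun x _ => h x

theorem expect_ind_le_one {α : Type*} [Fintype α] [Nonempty α] (p : α → Prop) :
    𝔼 x, ind (p x) ≤ 1 :=
  Finset.expect_le univ_nonempty fun _ _ => ind_le_one _

/-- A surjective homomorphism of finite groups maps the uniform distribution to the uniform
distribution. -/
theorem expect_comp_addHom {V W : Type*} [AddCommGroup V] [AddCommGroup W] [Fintype V] [Fintype W]
    (L : V →+ W) (hL : Function.Surjective L) (F : W → ℝ) :
    𝔼 x, F (L x) = 𝔼 y, F y := by
  -- the average does not change under translations, so it may be averaged over all of them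
  have shift : ∀ w : W, 𝔼 x, F (L x) = 𝔼 x, F (L x + w) := by
    intro w
    obtain ⟨u, rfl⟩ := hL w
    refine (Fintype.expect_equiv (Equiv.addRight u) _ _ fun x => ?_).symm
    simp
  calc 𝔼 x, F (L x) = 𝔼 _w : W, 𝔼 x, F (L x) := (Fintype.expect_const _).symm
    _ = 𝔼 w : W, 𝔼 x, F (L x + w) := Finset.expect_congr rfl fun w _ => shift w
    _ = 𝔼 x, 𝔼 w : W, F (L x + w) := Finset.expect_comm _ _ _
    _ = 𝔼 _x : V, 𝔼 w : W, F w := by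
        refine Finset.expect_congr rfl fun x _ => ?_
        exact Fintype.expect_equiv (Equiv.addLeft (L x)) _ _ fun w => rfl
    _ = 𝔼 y, F y := Fintype.expect_const _

/-- Bits as elements of the field with two elements. -/
def boolZMod : Bool ≃ ZMod 2 where
  toFun b := if b then 1 else 0
  invFun z := decide (z = 1)
  left_inv b := by cases b <;> decide
  right_inv z := by revert z; decide

theorem boolZMod_apply (b : Bool) : boolZMod b = if b then 1 else 0 := rfl

theorem boolZMod_decide (z : ZMod 2) : boolZMod (decide (z = 1)) = z :=
  boolZMod.right_inv z

/-- Bit strings as vectors over the field with two elements. -/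
def bitsZMod (ι : Type*) : (ι → Bool) ≃ (ι → ZMod 2) :=
  Equiv.arrowCongr (Equiv.refl ι) boolZMod

theorem bitsZMod_apply {ι : Type*} (x : ι → Bool) (i : ι) : bitsZMod ι x i = boolZMod (x i) := rfl

/-- The bits of a uniform bit string at distinct places are a uniform bit string. -/
theorem expect_comp_injective {ι κ : Type*} [Fintype ι] [Fintype κ] [DecidableEq ι] [DecidableEq κ]
    (e : κ → ι) (he : Function.Injective e) (F : (κ → Bool) → ℝ) :
    𝔼 x : ι → Bool, F (x ∘ e) = 𝔼 y : κ → Bool, F y := by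
  let L : (ι → ZMod 2) →+ (κ → ZMod 2) :=
    { toFun := fun x => x ∘ e, map_zero' := rfl, map_add' := fun _ _ => rfl }
  have hL : Function.Surjective L := fun y =>
    ⟨Function.extend e y 0, funext fun k => he.extend_apply y 0 k⟩
  rw [Fintype.expect_equiv (bitsZMod ι) (fun x => F (x ∘ e))
      (fun x => F ((bitsZMod κ).symm (L x))) fun x => ?_,
    expect_comp_addHom L hL fun y => F ((bitsZMod κ).symm y),
    Fintype.expect_equiv (bitsZMod κ) F (fun y => F ((bitsZMod κ).symm y)) fun x => by simp]
  congr 1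
  rw [Equiv.eq_symm_apply]
  rfl

/-- Resampling one coordinate of a uniform family leaves it uniform. -/
theorem expect_update {ι X : Type*} [Fintype ι] [DecidableEq ι] [Fintype X] [Nonempty X]
    (i : ι) (G : (ι → X) → ℝ) :
    𝔼 y, G y = 𝔼 y : ι → X, 𝔼 x : X, G (Function.update y i x) := by
  let e : (ι → X) × X ≃ (ι → X) × X :=
    { toFun := fun p => (Function.update p.1 i p.2, p.1 i)
      invFun := fun p => (Function.update p.1 i p.2, p.1 i)
      left_inv := fun p => by ext <;> simp
      right_inv := fun p => by ext <;> simp }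
  calc 𝔼 y, G y = 𝔼 y : ι → X, 𝔼 _x : X, G y :=
        Finset.expect_congr rfl fun y _ => (Fintype.expect_const _).symm
    _ = 𝔼 p : (ι → X) × X, G p.1 := (Finset.expect_product univ univ fun p => G p.1).symm
    _ = 𝔼 p : (ι → X) × X, G (Function.update p.1 i p.2) :=
        (Fintype.expect_equiv e _ _ fun p => rfl).symm
    _ = _ := Finset.expect_product univ univ fun p : (ι → X) × X => G (Function.update p.1 i p.2)

/-- The coordinates of a uniform family are independent. -/
theorem expect_prod_pi {ι X : Type*} [Fintype ι] [DecidableEq ι] [Fintype X]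
    (F : ι → X → ℝ) :
    𝔼 y : ι → X, ∏ i, F i (y i) = ∏ i, 𝔼 x, F i x := by
  simp only [Fintype.expect_eq_sum_div_card, Finset.prod_div_distrib, Finset.prod_univ_sum,
    Fintype.piFinset_univ, Fintype.card_fun, Finset.prod_const, Finset.card_univ, Nat.cast_pow]

/-- The Cauchy–Schwarz inequality, in the form used to pass from second to first moments. -/
theorem expect_abs_le_of_sq {α : Type*} [Fintype α] [Nonempty α] (f : α → ℝ) {η : ℝ} (hη : 0 ≤ η)
    (h : 𝔼 x, f x ^ 2 ≤ η ^ 2) : 𝔼 x, |f x| ≤ η := by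
  have := Finset.expect_mul_sq_le_sq_mul_sq univ (fun x => |f x|) (fun _ : α => (1 : ℝ))
  simp only [mul_one, sq_abs, one_pow, Fintype.expect_const] at this
  exact abs_le_of_sq_le_sq' (this.trans h) hη |>.2

/-! ### Four-wise independent bits from short seeds -/

theorem expect_ind_eq {α : Type*} [Fintype α] (a : α) :
    𝔼 y, ind (y = a) = 1 / (Fintype.card α : ℝ) := by
  rw [Fintype.expect_eq_sum_div_card]
  congr 1
  simp_rw [eq_comm (b := a)]
  exact sum_ind_eq a

/-- Over a finite field `F` of characteristic two with at least `n` elements, take a random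
polynomial of degree at most three and apply a nonzero additive functional `F → 𝔽₂` to its values
at `n` distinct points. Interpolation shows that any four of the resulting bits are
uniform and independent. -/
theorem isFourWise_of_field {F : Type} [Field F] [Fintype F] {n w : ℕ} (pt : Fin n ↪ F)
    (φ : F →+ ZMod 2) (hφ : Function.Surjective φ) (e : (Fin w → Bool) ≃ (Fin 4 → F)) :
    IsFourWise fun (x : Fin w → Bool) (j : Fin n) =>
      boolZMod.symm (φ (∑ i : Fin 4, e x i * pt j ^ (i : ℕ))) := by
  classical
  intro I hI b
  let L : (Fin 4 → F) →+ (I → ZMod 2) :=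
    { toFun := fun a j => φ (∑ i : Fin 4, a i * pt j ^ (i : ℕ))
      map_zero' := by ext j; simp
      map_add' := fun a a' => by
        ext j
        simp [add_mul, Finset.sum_add_distrib] }
  have hL : Function.Surjective L := by
    intro t
    choose u hu using fun j : I => hφ (t j)
    set P : Polynomial F := Lagrange.interpolate univ (fun j : I => pt j) u with hP
    have hinj : Set.InjOn (fun j : I => pt j) (univ : Finset I) := fun i _ j _ hij =>
      Subtype.ext (pt.injective hij)
    have hdeg : P.degree < 4 := by
      refine (Lagrange.degree_interpolate_lt u hinj).trans_le ?_
      rw [Finset.card_univ, Fintype.card_coe]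
      exact_mod_cast hI
    refine ⟨fun i => P.coeff i, ?_⟩
    ext j
    change φ (∑ i : Fin 4, P.coeff i * pt j ^ (i : ℕ)) = t j
    rw [Fin.sum_univ_eq_sum_range (fun i => P.coeff i * pt j ^ i) 4,
      ← Polynomial.eval_eq_sum_range' (n := 4) _ (pt j), hP,
      Lagrange.eval_interpolate_at_node u hinj (Finset.mem_univ j), hu]
    by_cases h0 : P = 0
    · rw [h0]; simp
    · exact (Polynomial.natDegree_lt_iff_degree_lt h0).2 hdeg
  rw [unifPr_eq_expect, Fintype.expect_equiv e _
    (fun a => ind (L a = fun j : I => boolZMod (b j))) fun x => ?_,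
    expect_comp_addHom L hL fun y => ind (y = fun j : I => boolZMod (b j)), expect_ind_eq]
  · simp [ZMod.card]
  · refine ind_congr ?_
    rw [funext_iff]
    simp only [Subtype.forall, Equiv.symm_apply_eq]
    rfl

/-- Logarithms to base two, rounded up, in terms of natural logarithms. -/
theorem clog_two_le (N : ℕ) (hN : 1 ≤ N) : (Nat.clog 2 N : ℝ) ≤ 2 * Real.log N + 1 := by
  rcases hN.eq_or_lt with rfl | h1
  · simp
  have h0 : 0 < Nat.clog 2 N := Nat.clog_pos (by norm_num) (by omega)
  have h := Nat.pow_pred_clog_lt_self (b := 2) (by norm_num) (x := N) (by omega)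
  have h' : ((2 : ℝ) ^ (Nat.clog 2 N).pred) ≤ N := by exact_mod_cast h.le
  have h2 := Real.log_le_log (by positivity) h'
  rw [Real.log_pow] at h2
  have h3 : ((Nat.clog 2 N).pred : ℝ) = Nat.clog 2 N - 1 := by
    rw [Nat.pred_eq_sub_one, Nat.cast_sub h0]; simp
  rw [h3] at h2
  have h4 := Real.log_two_gt_d9
  have h5 : (0 : ℝ) ≤ Nat.clog 2 N - 1 := by
    have : (1 : ℝ) ≤ Nat.clog 2 N := by exact_mod_cast h0
    linarith
  nlinarith

theorem one_le_log {n : ℕ} (hn : 3 ≤ n) : 1 ≤ Real.log n := by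
  rw [Real.le_log_iff_exp_le (by positivity)]
  have h1 := Real.exp_one_lt_d9
  have : (3 : ℝ) ≤ n := by exact_mod_cast hn
  linarith

/-- Four-wise independent bits can be generated from seeds of logarithmic length. -/
theorem exists_isFourWise (n : ℕ) (hn : 3 ≤ n) :
    ∃ (w : ℕ) (h : (Fin w → Bool) → Fin n → Bool),
      (w : ℝ) ≤ 12 * Real.log n ∧ IsFourWise h := by
  classical
  set m := Nat.clog 2 n with hm
  have hm0 : m ≠ 0 := (Nat.clog_pos (by norm_num) (by omega)).ne'
  have hcard : Nat.card (GaloisField 2 m) = 2 ^ m := GaloisField.card 2 m hm0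
  have : Finite (GaloisField 2 m) := Nat.finite_of_card_ne_zero (by rw [hcard]; positivity)
  let : Fintype (GaloisField 2 m) := Fintype.ofFinite _
  have hcard' : Fintype.card (GaloisField 2 m) = 2 ^ m := by
    rw [← Nat.card_eq_fintype_card]; exact hcard
  obtain ⟨pt⟩ : Nonempty (Fin n ↪ GaloisField 2 m) := by
    rw [Function.Embedding.nonempty_iff_card_le, hcard', Fintype.card_fin]
    exact Nat.le_pow_clog (by norm_num) n
  obtain ⟨φ, hφ⟩ : ∃ φ : Module.Dual (ZMod 2) (GaloisField 2 m), φ 1 ≠ 0 := by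
    by_contra! h
    exact one_ne_zero ((Module.forall_dual_apply_eq_zero_iff (ZMod 2) (1 : GaloisField 2 m)).1 h)
  have hφs : Function.Surjective φ.toAddMonoidHom := by
    intro t
    exact LinearMap.surjective (f := φ) (fun h => hφ (by rw [h]; rfl)) t
  have e : (Fin (4 * m) → Bool) ≃ (Fin 4 → GaloisField 2 m) :=
    Fintype.equivOfCardEq (by simp [hcard', ← pow_mul, mul_comm])
  refine ⟨4 * m, _, ?_, isFourWise_of_field pt φ.toAddMonoidHom hφs e⟩
  have h1 := clog_two_le n (by omega)
  have h2 := one_le_log hn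
  push_cast
  rw [← hm] at h1
  linarith

/-! ### Pairwise independence of affine convolution hashing -/

/-- A Hankel matrix acts on a fixed nonzero vector surjectively, as a function of the matrix: a
functional vanishing on all the values is a vector `c` whose convolution with `u` is zero, and the
lowest coefficients of `c` and `u` have a nonzero product. -/
theorem hankel_surjective {v : ℕ} (u : Fin v → ZMod 2) (hu : u ≠ 0) (t : Fin v → ZMod 2) :
    ∃ a : Fin (2 * v) → ZMod 2, ∀ i : Fin v, ∑ l : Fin v, a ⟨i + l, by omega⟩ * u l = t i := by
  classical
  let L : (Fin (2 * v) → ZMod 2) →ₗ[ZMod 2] (Fin v → ZMod 2) :=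
    { toFun := fun a i => ∑ l : Fin v, a ⟨i + l, by omega⟩ * u l
      map_add' := fun a b => by ext i; simp [add_mul, Finset.sum_add_distrib]
      map_smul' := fun r a => by ext i; simp [Finset.mul_sum, mul_assoc] }
  suffices h : LinearMap.range L = ⊤ by
    obtain ⟨a, ha⟩ := LinearMap.range_eq_top.1 h t
    exact ⟨a, fun i => congrFun ha i⟩
  by_contra hne
  obtain ⟨f, hf, hle⟩ := Submodule.exists_le_ker_of_lt_top _ (lt_top_iff_ne_top.2 hne)
  set c : Fin v → ZMod 2 := fun i => f (Pi.single i 1) with hc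
  have hfc : ∀ x, f x = ∑ i, x i * c i := fun x => by
    rw [LinearMap.pi_apply_eq_sum_univ f x]
    refine Finset.sum_congr rfl fun i _ => ?_
    rw [smul_eq_mul, hc]
    congr 2
    ext j
    simp [Pi.single_apply, eq_comm]
  have hc0 : ∃ i, c i ≠ 0 := by
    by_contra! h
    exact hf (LinearMap.ext fun x => by rw [hfc]; simp [h])
  obtain ⟨i₀, hi₀, hmin⟩ := WellFounded.has_min (wellFounded_lt (α := Fin v)) {i | c i ≠ 0} hc0
  obtain ⟨l₀, hl₀, hlmin⟩ := WellFounded.has_min (wellFounded_lt (α := Fin v)) {l | u l ≠ 0}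
    (Function.ne_iff.1 hu)
  have hzero : f (L (Pi.single ⟨i₀ + l₀, by omega⟩ 1)) = 0 :=
    hle (LinearMap.mem_range_self L _)
  rw [hfc] at hzero
  have hval : ∀ i l : Fin v, (Pi.single (⟨i₀ + l₀, by omega⟩ : Fin (2 * v)) (1 : ZMod 2) :
      Fin (2 * v) → ZMod 2) ⟨i + l, by omega⟩ * u l * c i =
      if i = i₀ ∧ l = l₀ then u l₀ * c i₀ else 0 := by
    intro i l
    by_cases hil : i = i₀ ∧ l = l₀
    · obtain ⟨rfl, rfl⟩ := hil; simp
    rw [if_neg hil]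
    by_cases hs : (i : ℕ) + l = i₀ + l₀
    · by_cases hi : i < i₀
      · have : c i = 0 := by by_contra h; exact hmin i h hi
        rw [this, mul_zero]
      · have hl : l < l₀ := by
          rw [Fin.lt_def] at hi ⊢
          by_contra hl
          exact hil ⟨Fin.ext (by omega), Fin.ext (by omega)⟩
        have : u l = 0 := by by_contra h; exact hlmin l h hl
        rw [this, mul_zero, zero_mul]
    · rw [Pi.single_eq_of_ne (by simpa [Fin.ext_iff] using hs), zero_mul, zero_mul]
  have hsum : ∑ i, L (Pi.single ⟨i₀ + l₀, by omega⟩ 1) i * c i = u l₀ * c i₀ := by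
    change ∑ i, (∑ l : Fin v, _ * u l) * c i = _
    simp_rw [Finset.sum_mul, hval]
    rw [Finset.sum_eq_single i₀, Finset.sum_eq_single l₀] <;> simp +contextual
  rw [hsum] at hzero
  exact mul_ne_zero hl₀ hi₀ hzero

/-- The function `x ↦ A x + b` for the Hankel matrix given by `a`, over `ZMod 2`. -/
def affineHankel {v : ℕ} (ab : (Fin (2 * v) → ZMod 2) × (Fin v → ZMod 2)) (x : Fin v → ZMod 2) :
    Fin v → ZMod 2 := fun i => ∑ l : Fin v, ab.1 ⟨i + l, by omega⟩ * x l + ab.2 i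

theorem bitsZMod_convHash {v : ℕ} (ab : HashSeed v) (x : Fin v → Bool) :
    bitsZMod _ (convHash ab x) =
      affineHankel (bitsZMod _ ab.1, bitsZMod _ ab.2) (bitsZMod _ x) := by
  ext i
  rw [bitsZMod_apply, convHash, boolZMod_decide, affineHankel]
  congr 1
  refine Finset.sum_congr rfl fun l _ => ?_
  simp only [bitsZMod_apply, boolZMod_apply]
  cases ab.1 ⟨i + l, by omega⟩ <;> cases x l <;> simp

/-- At two distinct points, a random hash function takes independent uniform values. -/
theorem expect_convHash_pair {v : ℕ} {x x' : Fin v → Bool} (hx : x ≠ x')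
    (F : (Fin v → Bool) × (Fin v → Bool) → ℝ) :
    𝔼 ab : HashSeed v, F (convHash ab x, convHash ab x') = 𝔼 p, F p := by
  classical
  let X := bitsZMod _ x
  let X' := bitsZMod _ x'
  let L : ((Fin (2 * v) → ZMod 2) × (Fin v → ZMod 2)) →+ (Fin v → ZMod 2) × (Fin v → ZMod 2) :=
    { toFun := fun ab => (affineHankel ab X, affineHankel ab X')
      map_zero' := by ext i <;> simp [affineHankel]
      map_add' := fun ab ab' => by
        ext i <;> simp [affineHankel, add_mul, Finset.sum_add_distrib] <;> ring }
  have hL : Function.Surjective L := by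
    rintro ⟨t, t'⟩
    have hu : X - X' ≠ 0 := sub_ne_zero.2 fun h => hx ((bitsZMod _).injective h)
    obtain ⟨a, ha⟩ := hankel_surjective (X - X') hu (t - t')
    refine ⟨(a, fun i => t i - ∑ l : Fin v, a ⟨i + l, by omega⟩ * X l), ?_⟩
    have h1 : ∀ i : Fin v, ∑ l : Fin v, a ⟨i + l, by omega⟩ * X l -
        ∑ l : Fin v, a ⟨i + l, by omega⟩ * X' l = t i - t' i := fun i => by
      rw [← Finset.sum_sub_distrib]
      simpa [mul_sub] using ha i
    refine Prod.ext (funext fun i => ?_) (funext fun i => ?_)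
    · change ∑ l : Fin v, _ + (_ - _) = _
      simp
    · change ∑ l : Fin v, _ + (_ - _) = _
      linear_combination -(h1 i)
  let E := Equiv.prodCongr (bitsZMod (Fin v)) (bitsZMod (Fin v))
  rw [Fintype.expect_equiv (Equiv.prodCongr (bitsZMod (Fin (2 * v))) (bitsZMod (Fin v)))
      (fun ab : HashSeed v => F (convHash ab x, convHash ab x')) (fun ab => F (E.symm (L ab)))
      fun ab => ?_,
    expect_comp_addHom L hL fun p => F (E.symm p),
    Fintype.expect_equiv E F (fun p => F (E.symm p)) fun p => by simp]
  congr 1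
  rw [Equiv.eq_symm_apply]
  exact Prod.ext (bitsZMod_convHash ab x) (bitsZMod_convHash ab x')

/-- On average over the hash function, the events `x ∈ A` and `convHash ab x ∈ B` are nearly
independent for random `x`. This is the mixing property behind Nisan's generator; the variance
of the probability is at most `2⁻ᵛ` by pairwise independence. -/
theorem expect_abs_mixing_le {v : ℕ} {η : ℝ} (hη : 0 ≤ η) (hv : (1 / 2 : ℝ) ^ v ≤ η ^ 2)
    (A B : (Fin v → Bool) → ℝ) (hA : ∀ x, 0 ≤ A x ∧ A x ≤ 1) (hB : ∀ x, 0 ≤ B x ∧ B x ≤ 1) :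
    𝔼 ab : HashSeed v, |𝔼 x, A x * B (convHash ab x) - (𝔼 x, A x) * 𝔼 x, B x| ≤ η := by
  classical
  set β := 𝔼 x, B x with hβ
  refine expect_abs_le_of_sq _ hη (le_trans ?_ hv)
  -- the deviation is an average over `x` of terms that are uncorrelated for distinct `x`
  have hdev : ∀ ab : HashSeed v, 𝔼 x, A x * B (convHash ab x) - (𝔼 x, A x) * β =
      𝔼 x, A x * (B (convHash ab x) - β) := fun ab => by
    rw [Finset.expect_mul, ← Finset.expect_sub_distrib]
    exact Finset.expect_congr rfl fun x _ => by ring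
  have hcov : ∀ x x' : Fin v → Bool,
      𝔼 ab : HashSeed v, (A x * (B (convHash ab x) - β)) * (A x' * (B (convHash ab x') - β)) ≤
        ind (x = x') := by
    intro x x'
    by_cases hxx : x = x'
    · subst hxx
      rw [ind_true rfl]
      refine Finset.expect_le univ_nonempty fun ab _ => ?_
      have hβ0 : 0 ≤ β := Finset.expect_nonneg fun y _ => (hB y).1
      have hβ1 : β ≤ 1 := Finset.expect_le univ_nonempty fun y _ => (hB y).2
      have h1 := hB (convHash ab x)
      have h2 : |A x * (B (convHash ab x) - β)| ≤ 1 := by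
        rw [abs_mul]
        exact mul_le_one₀ (abs_le.2 ⟨by linarith [hA x], (hA x).2⟩) (abs_nonneg _)
          (abs_le.2 ⟨by linarith, by linarith⟩)
      rw [← pow_two, ← sq_abs]
      exact pow_le_one₀ (abs_nonneg _) h2
    · rw [ind_false hxx,
        expect_convHash_pair hxx fun p => (A x * (B p.1 - β)) * (A x' * (B p.2 - β))]
      refine le_of_eq ?_
      have hz : 𝔼 y : Fin v → Bool, A x * (B y - β) = 0 := by
        rw [← Finset.mul_expect, Finset.expect_sub_distrib, Fintype.expect_const, ← hβ, sub_self,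
          mul_zero]
      refine (Finset.expect_product univ univ fun p : (Fin v → Bool) × (Fin v → Bool) =>
        (A x * (B p.1 - β)) * (A x' * (B p.2 - β))).trans ?_
      simp only
      rw [← Fintype.expect_mul_expect, hz, zero_mul]
  calc 𝔼 ab : HashSeed v, (𝔼 x, A x * B (convHash ab x) - (𝔼 x, A x) * β) ^ 2
      = 𝔼 ab : HashSeed v, 𝔼 x, 𝔼 x',
          (A x * (B (convHash ab x) - β)) * (A x' * (B (convHash ab x') - β)) := by
        refine Finset.expect_congr rfl fun ab _ => ?_
        rw [hdev, pow_two, Fintype.expect_mul_expect]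
    _ = 𝔼 x, 𝔼 x', 𝔼 ab : HashSeed v,
          (A x * (B (convHash ab x) - β)) * (A x' * (B (convHash ab x') - β)) := by
        rw [Finset.expect_comm]
        exact Finset.expect_congr rfl fun x _ => Finset.expect_comm _ _ _
    _ ≤ 𝔼 x : Fin v → Bool, 𝔼 x' : Fin v → Bool, ind (x = x') :=
        expect_mono fun x => expect_mono fun x' => hcov x x'
    _ = (1 / 2 : ℝ) ^ v := by
        have h : ∀ x : Fin v → Bool, 𝔼 x' : Fin v → Bool, ind (x = x') = (1 / 2 : ℝ) ^ v := by
          intro x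
          simp_rw [eq_comm (a := x), expect_ind_eq]
          simp
        simp_rw [h, Fintype.expect_const]

/-! ### Nisan's generator against read-once programs -/

/-- The state reached from `p` by a read-once program with transition function `step t` at time
`t`, which starts at time `t` and reads `len` blocks `y 0, y 1, …`. -/
def runFrom {Q X : Type*} (step : ℕ → Q → X → Q) (y : ℕ → X) (t : ℕ) : ℕ → Q → Q
  | 0, p => p
  | len + 1, p => step (t + len) (runFrom step y t len p) (y len)

theorem runFrom_add {Q X : Type*} (step : ℕ → Q → X → Q) (y : ℕ → X) (t a b : ℕ) (p : Q) :
    runFrom step y t (a + b) p =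
      runFrom step (fun i => y (a + i)) (t + a) b (runFrom step y t a p) := by
  induction b with
  | zero => rfl
  | succ b ih => rw [← Nat.add_assoc, runFrom, runFrom, ih, Nat.add_assoc]

theorem runFrom_congr {Q X X' : Type*} {step : ℕ → Q → X → Q} {step' : ℕ → Q → X' → Q}
    {y : ℕ → X} {y' : ℕ → X'} {t len : ℕ}
    (h : ∀ i < len, ∀ p, step (t + i) p (y i) = step' (t + i) p (y' i)) (p : Q) :
    runFrom step y t len p = runFrom step' y' t len p := by
  induction len with
  | zero => rfl
  | succ len ih =>
    rw [runFrom, runFrom, ih fun i hi => h i (by omega), h len (by omega)]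

/-- The transition probabilities of a program at time `t`, on a uniform block. -/
noncomputable def stepTrans {Q X : Type*} [Fintype X] (step : ℕ → Q → X → Q) (t : ℕ) :
    Matrix Q Q ℝ :=
  fun p q => 𝔼 x, ind (step t p x = q)

/-- The transition probabilities over `len` steps from time `t`, on independent uniform
blocks. -/
noncomputable def segTrans {Q X : Type*} [Fintype X] [Fintype Q] [DecidableEq Q]
    (step : ℕ → Q → X → Q) (t : ℕ) : ℕ → Matrix Q Q ℝ
  | 0 => 1
  | len + 1 => segTrans step t len * stepTrans step (t + len)

section
variable {Q X : Type*} [Fintype X] [Fintype Q] [DecidableEq Q]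

theorem segTrans_add (step : ℕ → Q → X → Q) (t a b : ℕ) :
    segTrans step t (a + b) = segTrans step t a * segTrans step (t + a) b := by
  induction b with
  | zero => simp [segTrans]
  | succ b ih => rw [← Nat.add_assoc, segTrans, segTrans, ih, Matrix.mul_assoc, Nat.add_assoc]

theorem segTrans_congr {X' : Type*} [Fintype X'] {step : ℕ → Q → X → Q} {step' : ℕ → Q → X' → Q}
    {t len : ℕ} (h : ∀ i < len, stepTrans step (t + i) = stepTrans step' (t + i)) :
    segTrans step t len = segTrans step' t len := by
  induction len with
  | zero => rfl
  | succ len ih => rw [segTrans, segTrans, ih fun i hi => h i (by omega), h len (by omega)]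

theorem segTrans_nonneg (step : ℕ → Q → X → Q) (t len : ℕ) (p q : Q) :
    0 ≤ segTrans step t len p q := by
  induction len generalizing q with
  | zero => rw [segTrans, Matrix.one_apply]; split_ifs <;> norm_num
  | succ len ih =>
    rw [segTrans, Matrix.mul_apply]
    exact Finset.sum_nonneg fun m _ =>
      mul_nonneg (ih m) (Finset.expect_nonneg fun x _ => ind_nonneg _)

theorem segTrans_row_sum [Nonempty X] (step : ℕ → Q → X → Q) (t len : ℕ) (p : Q) :
    ∑ q, segTrans step t len p q = 1 := by
  induction len with
  | zero => simp [segTrans, Matrix.one_apply]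
  | succ len ih =>
    simp only [segTrans, Matrix.mul_apply]
    rw [Finset.sum_comm, ← ih]
    refine Finset.sum_congr rfl fun m _ => ?_
    rw [← Finset.mul_sum]
    simp only [stepTrans]
    rw [← Finset.expect_sum_comm]
    simp [sum_ind_eq]

/-- On independent uniform blocks the transition probabilities are given by the matrix
product. -/
theorem expect_ind_runFrom [Nonempty X] (step : ℕ → Q → X → Q) (R : ℕ) (x₀ : X) (p : Q)
    (len : ℕ) (hlen : len ≤ R) (q : Q) :
    𝔼 y : Fin R → X, ind (runFrom step (fun i => if h : i < R then y ⟨i, h⟩ else x₀) 0 len p = q) =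
      segTrans step 0 len p q := by
  induction len generalizing q with
  | zero =>
    simp only [runFrom, segTrans, Matrix.one_apply]
    rw [Fintype.expect_const]
    simp [ind]
  | succ len ih =>
    have hl : len < R := by omega
    let ext : (Fin R → X) → ℕ → X := fun y i => if h : i < R then y ⟨i, h⟩ else x₀
    have key : ∀ (y : Fin R → X) (x : X),
        runFrom step (ext (Function.update y ⟨len, hl⟩ x)) 0 (len + 1) p =
          step (0 + len) (runFrom step (ext y) 0 len p) x := by
      intro y x
      rw [runFrom]
      congr 1
      · refine runFrom_congr (fun i hi p => ?_) p
        have : (⟨i, by omega⟩ : Fin R) ≠ ⟨len, hl⟩ := by simp [Fin.ext_iff]; omega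
        simp [ext, show i < R by omega, Function.update_of_ne this]
      · simp [ext, hl]
    rw [expect_update ⟨len, hl⟩]
    calc _ = 𝔼 y : Fin R → X, 𝔼 x : X, ind (step (0 + len) (runFrom step (ext y) 0 len p) x = q) :=
          Finset.expect_congr rfl fun y _ => Finset.expect_congr rfl fun x _ => by rw [← key y x]
      _ = 𝔼 y : Fin R → X, ∑ m, ind (runFrom step (ext y) 0 len p = m) *
            stepTrans step (0 + len) m q :=
          Finset.expect_congr rfl fun y _ =>
            (sum_ind_eq_mul _ fun m => stepTrans step (0 + len) m q).symm
      _ = _ := by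
          rw [Finset.expect_sum_comm, segTrans, Matrix.mul_apply]
          refine Finset.sum_congr rfl fun m _ => ?_
          rw [← Finset.expect_mul]
          congr 1
          exact ih (by omega) m

end

/-- The transition probabilities of a program over `2 ^ d` steps from time `t` when its blocks are
those of Nisan's generator with hash functions `hs` and a uniform initial block. -/
noncomputable def nisanTrans {Q : Type*} {v : ℕ} (step : ℕ → Q → (Fin v → Bool) → Q)
    (d : ℕ) (hs : Fin d → HashSeed v) (t : ℕ) (p q : Q) : ℝ :=
  𝔼 x, ind (runFrom step (nisanBlock d hs x) t (2 ^ d) p = q)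

theorem nisanTrans_nonneg {Q : Type*} {v : ℕ} (step : ℕ → Q → (Fin v → Bool) → Q)
    (d : ℕ) (hs : Fin d → HashSeed v) (t : ℕ) (p q : Q) : 0 ≤ nisanTrans step d hs t p q :=
  Finset.expect_nonneg fun _ _ => ind_nonneg _

theorem nisanTrans_row_sum {Q : Type*} [Fintype Q] {v : ℕ}
    (step : ℕ → Q → (Fin v → Bool) → Q)
    (d : ℕ) (hs : Fin d → HashSeed v) (t : ℕ) (p : Q) : ∑ q, nisanTrans step d hs t p q = 1 := by
  unfold nisanTrans
  rw [← Finset.expect_sum_comm]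
  simp [sum_ind_eq]

theorem runFrom_nisanBlock_succ {Q : Type*} {v : ℕ}
    (step : ℕ → Q → (Fin v → Bool) → Q) (d : ℕ)
    (hs : Fin (d + 1) → HashSeed v) (x : Fin v → Bool) (t : ℕ) (p : Q) :
    runFrom step (nisanBlock (d + 1) hs x) t (2 ^ (d + 1)) p =
      runFrom step (nisanBlock d (fun e => hs e.castSucc) (convHash (hs (Fin.last d)) x))
        (t + 2 ^ d) (2 ^ d)
        (runFrom step (nisanBlock d (fun e => hs e.castSucc) x) t (2 ^ d) p) := by
  rw [pow_succ, mul_two, runFrom_add]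
  rw [runFrom_congr (y' := nisanBlock d (fun e => hs e.castSucc) x) (step' := step) (p := p)]
  · refine runFrom_congr (fun i _ p => ?_) _
    simp [nisanBlock]
  · intro i hi p
    simp [nisanBlock, hi]

theorem nisanTrans_succ {Q : Type*} [Fintype Q] {v : ℕ}
    (step : ℕ → Q → (Fin v → Bool) → Q) (d : ℕ)
    (hs : Fin (d + 1) → HashSeed v) (t : ℕ) (p q : Q) :
    nisanTrans step (d + 1) hs t p q = ∑ m, 𝔼 x,
      ind (runFrom step (nisanBlock d (fun e => hs e.castSucc) x) t (2 ^ d) p = m) *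
      ind (runFrom step (nisanBlock d (fun e => hs e.castSucc) (convHash (hs (Fin.last d)) x))
        (t + 2 ^ d) (2 ^ d) m = q) := by
  unfold nisanTrans
  rw [← Finset.expect_sum_comm]
  refine Finset.expect_congr rfl fun x _ => ?_
  rw [runFrom_nisanBlock_succ, sum_ind_eq_mul _ fun m => ind (runFrom step _ _ _ m = q)]

/-- A deterministic bound for one doubling step: replacing both factors of a product of stochastic
matrices costs at most the sum of the two errors. -/
theorem sum_abs_mul_sub_le {Q : Type*} [Fintype Q] (M M' U U' : Q → Q → ℝ) (p : Q)
    (hM' : ∀ m q, 0 ≤ M' m q) (hM's : ∀ m, ∑ q, M' m q = 1) (hU : ∀ m, 0 ≤ U p m) :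
    ∑ q, |∑ m, M p m * M' m q - ∑ m, U p m * U' m q| ≤
      ∑ m, |M p m - U p m| + ∑ m, U p m * ∑ q, |M' m q - U' m q| := by
  calc ∑ q, |∑ m, M p m * M' m q - ∑ m, U p m * U' m q|
      ≤ ∑ q, ∑ m, (|M p m - U p m| * M' m q + U p m * |M' m q - U' m q|) := by
        refine Finset.sum_le_sum fun q _ => ?_
        rw [← Finset.sum_sub_distrib]
        refine (Finset.abs_sum_le_sum_abs _ _).trans (Finset.sum_le_sum fun m _ => ?_)
        have : M p m * M' m q - U p m * U' m q =
          (M p m - U p m) * M' m q + U p m * (M' m q - U' m q) := by ring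
        rw [this]
        refine (abs_add_le _ _).trans_eq ?_
        rw [abs_mul, abs_mul, abs_of_nonneg (hM' m q), abs_of_nonneg (hU m)]
    _ = _ := by
        rw [Finset.sum_comm]
        simp_rw [Finset.sum_add_distrib, ← Finset.mul_sum, hM's, mul_one]

/-- Nisan's bound: on average over the hash functions, the transition probabilities under the
generator are close to those on independent blocks. Each doubling of the number of blocks doubles
the error and adds one mixing error for each pair of an intermediate and a final state. -/
theorem expect_nisanTrans_sub_le {Q : Type*} [Fintype Q] [DecidableEq Q] {v : ℕ} {η : ℝ}
    (hη : 0 ≤ η) (hv : (1 / 2 : ℝ) ^ v ≤ η ^ 2)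
    (step : ℕ → Q → (Fin v → Bool) → Q) (d t : ℕ) (p : Q) :
    𝔼 hs : Fin d → HashSeed v,
      ∑ q, |nisanTrans step d hs t p q - segTrans step t (2 ^ d) p q| ≤
        (2 ^ d - 1) * ((Fintype.card Q : ℝ) ^ 2 * η) := by
  induction d generalizing t p with
  | zero =>
    refine le_of_eq ?_
    simp only [pow_zero, sub_self, zero_mul]
    refine Finset.expect_eq_zero fun hs _ => Finset.sum_eq_zero fun q _ => ?_
    simp [nisanTrans, segTrans, runFrom, nisanBlock, stepTrans]
  | succ d ih =>
    set ε := (2 ^ d - 1) * ((Fintype.card Q : ℝ) ^ 2 * η) with hε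
    let I : (Fin d → HashSeed v) → (Fin v → Bool) → Q → ℝ := fun hs x m =>
      ind (runFrom step (nisanBlock d hs x) t (2 ^ d) p = m)
    let J : (Fin d → HashSeed v) → (Fin v → Bool) → Q → Q → ℝ := fun hs x m q =>
      ind (runFrom step (nisanBlock d hs x) (t + 2 ^ d) (2 ^ d) m = q)
    let M := fun hs => nisanTrans step d hs t
    let M' := fun hs => nisanTrans step d hs (t + 2 ^ d)
    let U := segTrans step t (2 ^ d)
    let U' := segTrans step (t + 2 ^ d) (2 ^ d)
    let D : (Fin d → HashSeed v) → HashSeed v → ℝ := fun hs ab => ∑ q, ∑ m,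
      |𝔼 x, I hs x m * J hs (convHash ab x) m q - M hs p m * M' hs m q|
    let E : (Fin d → HashSeed v) → ℝ := fun hs =>
      ∑ m, |M hs p m - U p m| + ∑ m, U p m * ∑ q, |M' hs m q - U' m q|
    -- `D` is the mixing error of the last hash function, `E` the error of the two halves
    have hpoint : ∀ hs : Fin (d + 1) → HashSeed v,
        ∑ q, |nisanTrans step (d + 1) hs t p q - segTrans step t (2 ^ (d + 1)) p q| ≤
          D (fun e => hs e.castSucc) (hs (Fin.last d)) + E (fun e => hs e.castSucc) := by
      intro hs
      have hE := sum_abs_mul_sub_le (M fun e => hs e.castSucc) (M' fun e => hs e.castSucc) U U' p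
        (fun m q => nisanTrans_nonneg _ _ _ _ _ _) (fun m => nisanTrans_row_sum _ _ _ _ _)
        (fun m => segTrans_nonneg _ _ _ _ _)
      refine le_trans ?_ (add_le_add_right hE _)
      rw [← Finset.sum_add_distrib]
      refine Finset.sum_le_sum fun q _ => ?_
      rw [nisanTrans_succ, pow_succ, mul_two, segTrans_add, Matrix.mul_apply]
      refine (abs_sub_le _ (∑ m, M (fun e => hs e.castSucc) p m * M' (fun e => hs e.castSucc) m q)
        _).trans (add_le_add_left ?_ _)
      rw [← Finset.sum_sub_distrib]
      exact Finset.abs_sum_le_sum_abs _ _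
    have hD : ∀ hs, 𝔼 ab, D hs ab ≤ (Fintype.card Q : ℝ) ^ 2 * η := by
      intro hs
      simp only [D]
      rw [Finset.expect_sum_comm]
      simp_rw [Finset.expect_sum_comm]
      calc _ ≤ ∑ _q : Q, ∑ _m : Q, η := by
            refine Finset.sum_le_sum fun q _ => Finset.sum_le_sum fun m _ => ?_
            exact expect_abs_mixing_le hη hv (fun x => I hs x m) (fun x => J hs x m q)
              (fun x => ⟨ind_nonneg _, ind_le_one _⟩) (fun x => ⟨ind_nonneg _, ind_le_one _⟩)
        _ = _ := by simp; ring
    have hE : 𝔼 hs, E hs ≤ 2 * ε := by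
      simp only [E]
      rw [Finset.expect_add_distrib, Finset.expect_sum_comm univ univ fun hs m =>
        U p m * ∑ q, |M' hs m q - U' m q|]
      have h1 := ih t p
      have h2 : ∑ m, 𝔼 hs, U p m * ∑ q, |M' hs m q - U' m q| ≤ ∑ m, U p m * ε := by
        refine Finset.sum_le_sum fun m _ => ?_
        rw [← Finset.mul_expect]
        exact mul_le_mul_of_nonneg_left (ih (t + 2 ^ d) m) (segTrans_nonneg _ _ _ _ _)
      rw [← Finset.sum_mul, segTrans_row_sum, one_mul] at h2
      linarith
    calc _ ≤ 𝔼 hs : Fin (d + 1) → HashSeed v,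
          (D (fun e => hs e.castSucc) (hs (Fin.last d)) + E (fun e => hs e.castSucc)) :=
          expect_mono hpoint
      _ = 𝔼 r : HashSeed v × (Fin d → HashSeed v), (D r.2 r.1 + E r.2) :=
          Fintype.expect_equiv (Fin.snocEquiv fun _ => HashSeed v).symm _ _ fun hs => rfl
      _ = 𝔼 ab : HashSeed v, 𝔼 hs : Fin d → HashSeed v, (D hs ab + E hs) :=
          Finset.expect_product univ univ fun r : HashSeed v × (Fin d → HashSeed v) =>
            (D r.2 r.1 + E r.2)
      _ = 𝔼 hs : Fin d → HashSeed v, 𝔼 ab : HashSeed v, D hs ab + 𝔼 hs, E hs := by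
          rw [Finset.expect_comm, ← Finset.expect_add_distrib]
          refine Finset.expect_congr rfl fun hs _ => ?_
          rw [Finset.expect_add_distrib, Fintype.expect_const]
      _ ≤ (Fintype.card Q : ℝ) ^ 2 * η + 2 * ε :=
          add_le_add (Finset.expect_le univ_nonempty fun hs _ => hD hs) hE
      _ = _ := by rw [hε, pow_succ]; ring

/-- Nisan's generator fools a program that in each of `R ≤ 2 ^ d` rounds reads the first `c` bits of
a block: any event about its final state keeps its probability up to `2 ^ d * |Q| ^ 2 * η`. -/
theorem nisan_fools {Q : Type*} [Fintype Q] [DecidableEq Q] {c v R d : ℕ} {η : ℝ}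
    (hη : 0 ≤ η) (hv : (1 / 2 : ℝ) ^ v ≤ η ^ 2) (hcv : c ≤ v)
    (hR : R ≤ 2 ^ d) (step : ℕ → Q → (Fin c → Bool) → Q) (p : Q) (acc : Q → Prop)
    (x₀ : Fin c → Bool) :
    |𝔼 z : NisanSeed v d, ind (acc (runFrom step
        (fun i l => nisanBlock d z.2 z.1 i (Fin.castLE hcv l)) 0 R p)) -
      𝔼 y : Fin R → Fin c → Bool, ind (acc (runFrom step
        (fun i => if h : i < R then y ⟨i, h⟩ else x₀) 0 R p))| ≤
      2 ^ d * ((Fintype.card Q : ℝ) ^ 2 * η) := by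
  -- the same program on full blocks, idle from time `R` on
  let st : ℕ → Q → (Fin v → Bool) → Q := fun t p x =>
    if t < R then step t p (x ∘ Fin.castLE hcv) else p
  have hidle : ∀ (y : ℕ → Fin v → Bool) (len : ℕ) (p : Q), runFrom st y (0 + R) len p = p := by
    intro y len p
    induction len with
    | zero => rfl
    | succ len ih => rw [runFrom, ih]; simp [st]
  have hidleT : ∀ len, segTrans st (0 + R) len = 1 := by
    intro len
    induction len with
    | zero => rfl
    | succ len ih =>
      rw [segTrans, ih, one_mul]
      ext p q
      simp only [stepTrans, st, zero_add, show ¬ R + len < R by omega, if_false,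
        Fintype.expect_const, Matrix.one_apply]
      simp [ind]
  have hrun : ∀ y : ℕ → Fin v → Bool,
      runFrom st y 0 (2 ^ d) p = runFrom step (fun i => y i ∘ Fin.castLE hcv) 0 R p := by
    intro y
    obtain ⟨k, hk⟩ := Nat.exists_eq_add_of_le hR
    rw [hk, runFrom_add, hidle]
    exact runFrom_congr (fun i hi p => by simp [st, hi]) p
  have hseg : segTrans st 0 (2 ^ d) = segTrans step 0 R := by
    obtain ⟨k, hk⟩ := Nat.exists_eq_add_of_le hR
    rw [hk, segTrans_add, hidleT, mul_one]
    refine segTrans_congr fun i hi => ?_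
    ext p q
    simp only [stepTrans, st, zero_add, hi, if_true]
    exact expect_comp_injective (Fin.castLE hcv) (Fin.castLE_injective hcv)
      fun x => ind (step i p x = q)
  have hacc : ∀ a : Q, ind (acc a) = ∑ q, ind (a = q) * ind (acc q) := fun a =>
    (sum_ind_eq_mul a fun q => ind (acc q)).symm
  have h1 : 𝔼 z : NisanSeed v d, ind (acc (runFrom step
      (fun i l => nisanBlock d z.2 z.1 i (Fin.castLE hcv l)) 0 R p)) =
      𝔼 hs : Fin d → HashSeed v, ∑ q, nisanTrans st d hs 0 p q * ind (acc q) := by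
    refine (Finset.expect_product univ univ fun z : NisanSeed v d => ind (acc (runFrom step
      (fun i l => nisanBlock d z.2 z.1 i (Fin.castLE hcv l)) 0 R p))).trans ?_
    rw [Finset.expect_comm]
    refine Finset.expect_congr rfl fun hs _ => ?_
    simp_rw [nisanTrans, Finset.expect_mul]
    rw [← Finset.expect_sum_comm]
    refine Finset.expect_congr rfl fun x _ => ?_
    rw [hacc]
    refine Finset.sum_congr rfl fun q _ => ?_
    rw [hrun]
    rfl
  have h2 : 𝔼 y : Fin R → Fin c → Bool, ind (acc (runFrom step
      (fun i => if h : i < R then y ⟨i, h⟩ else x₀) 0 R p)) =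
      𝔼 _hs : Fin d → HashSeed v, ∑ q, segTrans st 0 (2 ^ d) p q * ind (acc q) := by
    rw [Fintype.expect_const, hseg]
    simp_rw [hacc (runFrom _ _ _ _ _)]
    rw [Finset.expect_sum_comm]
    refine Finset.sum_congr rfl fun q _ => ?_
    rw [← Finset.expect_mul, expect_ind_runFrom step R x₀ p R le_rfl q]
  rw [h1, h2, ← Finset.expect_sub_distrib]
  refine (Finset.abs_expect_le _ _).trans ?_
  calc _ ≤ 𝔼 hs : Fin d → HashSeed v,
        ∑ q, |nisanTrans st d hs 0 p q - segTrans st 0 (2 ^ d) p q| := by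
        refine expect_mono fun hs => ?_
        rw [← Finset.sum_sub_distrib]
        refine (Finset.abs_sum_le_sum_abs _ _).trans (Finset.sum_le_sum fun q _ => ?_)
        rw [← sub_mul, abs_mul, abs_of_nonneg (ind_nonneg _)]
        exact mul_le_of_le_one_right (abs_nonneg _) (ind_le_one _)
    _ ≤ (2 ^ d - 1) * ((Fintype.card Q : ℝ) ^ 2 * η) := expect_nisanTrans_sub_le hη hv st d 0 p
    _ ≤ _ := mul_le_mul_of_nonneg_right (by linarith) (by positivity)

/-! ### The auxiliary algorithm of an item -/

/-- Item `j` wins a round with substream `T` and random bits `y`. -/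
def Wins {n s k w : ℕ} (h : (Fin w → Bool) → Fin n → Bool) (T : List (Fin n)) (j : Fin n)
    (y : Chunk s k w) : Prop :=
  hashBits h y j = pairBit h T y

/-- One round of the auxiliary algorithm: a counter of won rounds, kept modulo `R + 1`. -/
noncomputable def auxStep {n s k w R : ℕ} (h : (Fin w → Bool) → Fin n → Bool) (S : List (Fin n))
    (q : Fin (R + 1) → ℕ) (j : Fin n) (t : ℕ) (p : Fin (R + 1)) (y : Chunk s k w) : Fin (R + 1) :=
  open Classical in
  if ∃ ht : t < R, Wins h (roundStream S q ⟨t, ht⟩) j y then p + 1 else p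

theorem runFrom_auxStep {n s k w R : ℕ} (h : (Fin w → Bool) → Fin n → Bool) (S : List (Fin n))
    (q : Fin (R + 1) → ℕ) (j : Fin n) (y : Fin R → Chunk s k w) (y' : ℕ → Chunk s k w)
    (hy : ∀ r : Fin R, y' r = y r) :
    ((runFrom (auxStep h S q j) y' 0 R 0 : Fin (R + 1)) : ℕ) = itemWins h S q y j := by
  classical
  have key : ∀ len ≤ R, ((runFrom (auxStep h S q j) y' 0 len 0 : Fin (R + 1)) : ℕ) =
      ∑ t ∈ range len, if ∃ ht : t < R, Wins h (roundStream S q ⟨t, ht⟩) j (y' t)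
        then 1 else 0 := by
    intro len hlen
    induction len with
    | zero => simp [runFrom]
    | succ len ih =>
      have ih' := ih (by omega)
      -- the counter is still below `R`, so that it does not wrap around
      have hlt : ((runFrom (auxStep h S q j) y' 0 len 0 : Fin (R + 1)) : ℕ) < R := by
        rw [ih']
        refine lt_of_le_of_lt ?_ hlen
        refine (Finset.sum_le_card_nsmul _ _ 1 fun t _ => ?_).trans_eq (by simp)
        split_ifs <;> simp
      rw [runFrom, Finset.sum_range_succ, ← ih', auxStep, zero_add]
      split_ifs with hw
      · rw [Fin.val_add_one_of_lt (by rw [Fin.lt_def]; simpa using hlt)]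
      · rfl
  have hN : (∑ t ∈ range R, if ∃ ht : t < R, Wins h (roundStream S q ⟨t, ht⟩) j (y' t)
      then 1 else 0) = itemWins h S q y j := by
    rw [itemWins, wins, Finset.card_filter,
      ← Fin.sum_univ_eq_sum_range (fun t => if ∃ ht : t < R,
        Wins h (roundStream S q ⟨t, ht⟩) j (y' t) then 1 else 0) R]
    refine Finset.sum_congr rfl fun r _ => ?_
    have he : (∃ ht : (r : ℕ) < R, Wins h (roundStream S q ⟨r, ht⟩) j (y' r)) ↔
        hashBits h (y r) j = sieve h S q y r := by
      rw [hy]; exact ⟨fun ⟨_, hw⟩ => hw, fun hw => ⟨r.2, hw⟩⟩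
    exact if_congr he rfl rfl
  rw [key R le_rfl, hN]

/-- Nisan's generator fools the auxiliary algorithm of every item. -/
theorem auxBit_fooled {n s k w R v d : ℕ} {η : ℝ} (hη : 0 ≤ η) (hv : (1 / 2 : ℝ) ^ v ≤ η ^ 2)
    (hcv : chunkBits s k w ≤ v) (hR : R ≤ 2 ^ d) (h : (Fin w → Bool) → Fin n → Bool)
    (S : List (Fin n)) (q : Fin (R + 1) → ℕ) (j : Fin n) :
    |unifPr (fun z : NisanSeed v d => auxBit h S q j (nisanChunks hcv R d z) = true) -
        unifPr (fun y : Fin R → Chunk s k w => auxBit h S q j y = true)| ≤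
      2 ^ d * (((R : ℝ) + 1) ^ 2 * η) := by
  classical
  have hmain := nisan_fools (Q := Fin (R + 1)) hη hv hcv hR (auxStep (s := s) (k := k) h S q j) 0
    (fun p => 3 * (R : ℝ) / 4 < ((p : ℕ) : ℝ)) (fun _ => false)
  rw [unifPr_eq_expect, unifPr_eq_expect]
  have h1 : ∀ z : NisanSeed v d, ind (auxBit h S q j (nisanChunks hcv R d z) = true) =
      ind (3 * (R : ℝ) / 4 < (((runFrom (auxStep (s := s) (k := k) h S q j)
        (fun i l => nisanBlock d z.2 z.1 i (Fin.castLE hcv l)) 0 R 0 : Fin (R + 1)) : ℕ) : ℝ)) := by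
    intro z
    rw [runFrom_auxStep h S q j (nisanChunks hcv R d z) _ fun r => rfl, auxBit]
    exact ind_congr decide_eq_true_iff
  have h2 : ∀ y : Fin R → Chunk s k w, ind (auxBit h S q j y = true) =
      ind (3 * (R : ℝ) / 4 < (((runFrom (auxStep (s := s) (k := k) h S q j)
        (fun i => if h : i < R then y ⟨i, h⟩ else fun _ => false) 0 R 0 : Fin (R + 1)) : ℕ) :
          ℝ)) := by
    intro y
    rw [runFrom_auxStep h S q j y _ fun r => by simp, auxBit]
    exact ind_congr decide_eq_true_iff
  simp_rw [h1, h2]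
  refine hmain.trans_eq ?_
  simp

/-! ### One round with truly random bits -/

theorem IsFourWise.expect_eq {n w : ℕ} {h : (Fin w → Bool) → Fin n → Bool} (hh : IsFourWise h)
    {i j : Fin n} (hij : i ≠ j) : 𝔼 x, ind (h x i = h x j) = 1 / 2 := by
  have hcard : ({i, j} : Finset (Fin n)).card = 2 := Finset.card_pair hij
  have hb : ∀ b : Bool, 𝔼 x, ind (∀ l ∈ ({i, j} : Finset (Fin n)), h x l = b) = 1 / 4 := by
    intro b
    have := hh {i, j} (by rw [hcard]; norm_num) fun _ => b
    rw [unifPr_eq_expect, hcard] at this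
    rw [this]; norm_num
  have hsplit : ∀ x, ind (h x i = h x j) =
      ind (∀ l ∈ ({i, j} : Finset (Fin n)), h x l = true) +
        ind (∀ l ∈ ({i, j} : Finset (Fin n)), h x l = false) := by
    intro x
    cases h1 : h x i <;> cases h2 : h x j <;> simp [ind, h1, h2]
  simp_rw [hsplit]
  rw [Finset.expect_add_distrib, hb, hb]
  norm_num

theorem sgn_mul_sgn (a b : Bool) : sgn a * sgn b = 2 * ind (a = b) - 1 := by
  cases a <;> cases b <;> norm_num [sgn, ind]

/-- The second moment of a random signed sum. -/
theorem IsFourWise.expect_signed_sum_sq {n w : ℕ} {h : (Fin w → Bool) → Fin n → Bool}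
    (hh : IsFourWise h) (g : Fin n → ℝ) :
    𝔼 x, (∑ j, sgn (h x j) * g j) ^ 2 = ∑ j, g j ^ 2 := by
  have hcorr : ∀ i j : Fin n, 𝔼 x, sgn (h x i) * sgn (h x j) = if i = j then 1 else 0 := by
    intro i j
    simp_rw [sgn_mul_sgn]
    rw [Finset.expect_sub_distrib, ← Finset.mul_expect, Fintype.expect_const]
    by_cases hij : i = j
    · subst hij
      simp_rw [ind_true, Fintype.expect_const]
      norm_num
    · rw [hh.expect_eq hij, if_neg hij]; norm_num
  calc 𝔼 x, (∑ j, sgn (h x j) * g j) ^ 2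
      = 𝔼 x, ∑ i, ∑ j, (sgn (h x i) * sgn (h x j)) * (g i * g j) := by
        refine Finset.expect_congr rfl fun x _ => ?_
        rw [pow_two, Finset.sum_mul_sum]
        exact Finset.sum_congr rfl fun i _ => Finset.sum_congr rfl fun j _ => by ring
    _ = ∑ i, ∑ j, (if i = j then 1 else 0) * (g i * g j) := by
        rw [Finset.expect_sum_comm]
        refine Finset.sum_congr rfl fun i _ => ?_
        rw [Finset.expect_sum_comm]
        refine Finset.sum_congr rfl fun j _ => ?_
        rw [← Finset.expect_mul, hcorr]
    _ = ∑ j, g j ^ 2 := by simp [pow_two]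

/-- A chunk as its family of seeds. -/
def chunkEquiv (s k w : ℕ) : Chunk s k w ≃ (Fin (numSeeds s k) → Fin w → Bool) where
  toFun y := y.seed
  invFun f t := f (finProdFinEquiv.symm t).1 (finProdFinEquiv.symm t).2
  left_inv y := by
    ext t
    exact congrArg y (finProdFinEquiv.apply_symm_apply t)
  right_inv f := by ext i l; simp [Chunk.seed]

/-- Resampling one seed of a uniform chunk leaves it uniform. -/
theorem expect_update_seed {s k w : ℕ} (i : Fin (numSeeds s k))
    (G : (Fin (numSeeds s k) → Fin w → Bool) → ℝ) :
    𝔼 y : Chunk s k w, G y.seed = 𝔼 y : Chunk s k w, 𝔼 x, G (Function.update y.seed i x) := by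
  rw [Fintype.expect_equiv (chunkEquiv s k w) (fun y => G y.seed) G fun y => rfl, expect_update i,
    Fintype.expect_equiv (chunkEquiv s k w) (fun y => 𝔼 x, G (Function.update y.seed i x))
      (fun f => 𝔼 x, G (Function.update f i x)) fun y => rfl]

/-- The side of the split that the sketch number `b` works on. -/
def side (b : Fin 2) : Bool := decide (b = 1)

/-- The contribution to a signed sum on side `b` of the items other than `H`. -/
noncomputable def noise {n s k w : ℕ} (h : (Fin w → Bool) → Fin n → Bool) (T : List (Fin n))
    (H : Fin n) (y : Chunk s k w) (b : Fin 2) (g : Fin (2 * k + 1)) (l : Fin s) : ℝ :=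
  ∑ j, sgn (signBits h y b g l j) *
    (if j ≠ H ∧ hashBits h y j = side b then (T.count j : ℝ) else 0)

theorem expect_noise_sq_le {n s k w : ℕ} {h : (Fin w → Bool) → Fin n → Bool} (hh : IsFourWise h)
    (T : List (Fin n)) (H : Fin n) (b : Fin 2) (g : Fin (2 * k + 1)) (l : Fin s) :
    𝔼 y : Chunk s k w, noise h T H y b g l ^ 2 ≤
      ∑ j ∈ univ.erase H, (T.count j : ℝ) ^ 2 := by
  let i : Fin (numSeeds s k) := Fin.succ (finProdFinEquiv (b, finProdFinEquiv (g, l)))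
  let o : Fin (numSeeds s k) := (0 : Fin (2 * ((2 * k + 1) * s) + 1))
  -- resampling the seed of the sign vector does not affect the hash bits
  have hoi : o ≠ i := (Fin.succ_ne_zero _).symm
  refine (expect_update_seed i fun f : Fin (numSeeds s k) → Fin w → Bool =>
    (∑ j, sgn (h (f i) j) *
      (if j ≠ H ∧ h (f o) j = side b then (T.count j : ℝ) else 0)) ^ 2).trans_le ?_
  refine Finset.expect_le univ_nonempty fun y _ => ?_
  simp only [Function.update_self, Function.update_of_ne hoi]
  rw [hh.expect_signed_sum_sq, ← Finset.sum_erase_add univ _ (Finset.mem_univ H)]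
  simp only [ne_eq, not_true_eq_false, false_and, if_false]
  rw [zero_pow two_ne_zero, add_zero]
  refine Finset.sum_le_sum fun j _ => ?_
  split_ifs
  · exact le_rfl
  · rw [zero_pow two_ne_zero]; positivity

/-- More than half of the values are at most the median. -/
theorem card_le_median {k : ℕ} (x : Fin (2 * k + 1) → ℝ) :
    k + 1 ≤ (univ.filter fun g => x g ≤ median x).card := by
  have hm : Monotone (x ∘ Tuple.sort x) := Tuple.monotone_sort x
  have hsub : (Finset.Iic (⟨k, by omega⟩ : Fin (2 * k + 1))).map (Tuple.sort x).toEmbedding ⊆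
      univ.filter fun g => x g ≤ median x := by
    intro g hg
    obtain ⟨i, hi, rfl⟩ := Finset.mem_map.1 hg
    exact Finset.mem_filter.2 ⟨Finset.mem_univ _, hm (Finset.mem_Iic.1 hi)⟩
  refine le_trans ?_ (Finset.card_le_card hsub)
  rw [Finset.card_map, Fin.card_Iic]

/-- More than half of the values are at least the median. -/
theorem card_median_le {k : ℕ} (x : Fin (2 * k + 1) → ℝ) :
    k + 1 ≤ (univ.filter fun g => median x ≤ x g).card := by
  have hm : Monotone (x ∘ Tuple.sort x) := Tuple.monotone_sort x
  have hsub : (Finset.Ici (⟨k, by omega⟩ : Fin (2 * k + 1))).map (Tuple.sort x).toEmbedding ⊆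
      univ.filter fun g => median x ≤ x g := by
    intro g hg
    obtain ⟨i, hi, rfl⟩ := Finset.mem_map.1 hg
    exact Finset.mem_filter.2 ⟨Finset.mem_univ _, hm (Finset.mem_Ici.1 hi)⟩
  refine le_trans ?_ (Finset.card_le_card hsub)
  rw [Finset.card_map, Fin.card_Ici]
  simp only
  omega

theorem count_filter_eq {n : ℕ} (T : List (Fin n)) (B : Fin n → Bool) (b : Bool) (j : Fin n) :
    ((T.filter fun j => B j = b).count j : ℝ) = if B j = b then (T.count j : ℝ) else 0 := by
  split_ifs with hj
  · rw [List.count_filter (by simpa using hj)]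
  · rw [List.count_eq_zero_of_not_mem (by simp [hj])]; simp

/-- A signed sum on one side is the noise plus, on the side of `H`, the contribution of `H`. -/
theorem signed_sum_eq {n s k w : ℕ} (h : (Fin w → Bool) → Fin n → Bool) (T : List (Fin n))
    (H : Fin n) (y : Chunk s k w) (b : Fin 2) (g : Fin (2 * k + 1)) (l : Fin s) :
    ∑ j, sgn (signBits h y b g l j) *
        ((T.filter fun j => hashBits h y j = side b).count j : ℝ) =
      noise h T H y b g l + sgn (signBits h y b g l H) *
        (if hashBits h y H = side b then (T.count H : ℝ) else 0) := by
  simp only [noise, count_filter_eq]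
  rw [← Finset.sum_erase_add univ _ (Finset.mem_univ H),
    ← Finset.sum_erase_add univ (fun j => _ * if j ≠ H ∧ _ then _ else _) (Finset.mem_univ H)]
  simp only [ne_eq, not_true_eq_false, false_and, if_false, mul_zero, add_zero]
  congr 1
  refine Finset.sum_congr rfl fun j hj => ?_
  simp [Finset.ne_of_mem_erase hj]

theorem sgn_sq (b : Bool) : sgn b ^ 2 = 1 := by cases b <;> norm_num [sgn]

/-- The AMS estimate on side `b` in a round. -/
noncomputable def sideEstimate {n s k w : ℕ} (h : (Fin w → Bool) → Fin n → Bool)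
    (T : List (Fin n)) (y : Chunk s k w) (b : Fin 2) : ℝ :=
  amsEstimate (signBits h y b) (T.filter fun j => hashBits h y j = side b)

/-- If at least `k + 1` groups on side `b` have large noise, then the total noise is large. -/
theorem le_sum_noise_sq {n s k w : ℕ} (h : (Fin w → Bool) → Fin n → Bool) (T : List (Fin n))
    (H : Fin n) (y : Chunk s k w) (b : Fin 2) (G : Finset (Fin (2 * k + 1))) (hG : k + 1 ≤ G.card)
    (τ : ℝ) (hτ : 0 ≤ τ) (hb : ∀ g ∈ G, τ ≤ ∑ l, noise h T H y b g l ^ 2) :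
    (k + 1) * τ ≤ ∑ b, ∑ g, ∑ l, noise h T H y b g l ^ 2 := by
  have h0 : ∀ b g, 0 ≤ ∑ l, noise h T H y b g l ^ 2 := fun b g =>
    Finset.sum_nonneg fun l _ => sq_nonneg _
  calc (k + 1) * τ ≤ G.card * τ := mul_le_mul_of_nonneg_right (by exact_mod_cast hG) hτ
    _ = ∑ _g ∈ G, τ := by simp
    _ ≤ ∑ g ∈ G, ∑ l, noise h T H y b g l ^ 2 := Finset.sum_le_sum hb
    _ ≤ ∑ g, ∑ l, noise h T H y b g l ^ 2 :=
        Finset.sum_le_sum_of_subset_of_nonneg (Finset.subset_univ _) fun g _ _ => h0 b g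
    _ ≤ _ := Finset.single_le_sum (f := fun b => ∑ g, ∑ l, noise h T H y b g l ^ 2)
        (fun b _ => Finset.sum_nonneg fun g _ => h0 b g) (Finset.mem_univ b)

/-- If the side without `H` is estimated at least as large as the side of `H`, then the noise is
large: either more than half of the groups on the light side have an average of at least
`f_H² / 4`, or more than half of those on the heavy side have one of at most `f_H² / 4`, and
`(a + b)² ≥ a² / 2 - b²` turns the latter into large noise, too. -/
theorem le_sum_noise_sq_of_estimate_le {n s k w : ℕ} (hs : 0 < s)
    (h : (Fin w → Bool) → Fin n → Bool)
    (T : List (Fin n)) (H : Fin n) (y : Chunk s k w) (b b' : Fin 2)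
    (hb : hashBits h y H = side b) (hb' : hashBits h y H ≠ side b')
    (hle : sideEstimate h T y b ≤ sideEstimate h T y b') :
    (k + 1) * (s * ((T.count H : ℝ) ^ 2 / 4)) ≤
      ∑ b, ∑ g, ∑ l, noise h T H y b g l ^ 2 := by
  have hs' : (0 : ℝ) < s := by exact_mod_cast hs
  set τ : ℝ := (T.count H : ℝ) ^ 2 / 4 with hτ
  have hτ0 : 0 ≤ s * τ := by positivity
  rcases le_total τ (sideEstimate h T y b') with hc | hc
  · refine le_sum_noise_sq h T H y b' _ (card_median_le fun g => (∑ l : Fin s,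
      (∑ j : Fin n, sgn (signBits h y b' g l j) *
        ((T.filter fun j => hashBits h y j = side b').count j : ℝ)) ^ 2) / (s : ℝ)) _ hτ0
      fun g hg => ?_
    have h1 := hc.trans (Finset.mem_filter.1 hg).2
    simp only [signed_sum_eq h T H, if_neg hb', mul_zero, add_zero] at h1
    rwa [le_div_iff₀ hs', mul_comm] at h1
  · refine le_sum_noise_sq h T H y b _ (card_le_median fun g => (∑ l : Fin s,
      (∑ j : Fin n, sgn (signBits h y b g l j) *
        ((T.filter fun j => hashBits h y j = side b).count j : ℝ)) ^ 2) / (s : ℝ)) _ hτ0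
      fun g hg => ?_
    have h1 := (Finset.mem_filter.1 hg).2.trans (hle.trans hc)
    simp only [signed_sum_eq h T H, if_pos hb] at h1
    rw [div_le_iff₀ hs'] at h1
    have h2 : ∀ l : Fin s, (T.count H : ℝ) ^ 2 / 2 - noise h T H y b g l ^ 2 ≤
        (noise h T H y b g l + sgn (signBits h y b g l H) * (T.count H : ℝ)) ^ 2 := by
      intro l
      have := sgn_sq (signBits h y b g l H)
      set σ := sgn (signBits h y b g l H)
      have h3 : (σ * (T.count H : ℝ)) ^ 2 = (T.count H : ℝ) ^ 2 := by rw [mul_pow, this, one_mul]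
      nlinarith [sq_nonneg (2 * noise h T H y b g l + σ * (T.count H : ℝ))]
    have h3 := Finset.sum_le_sum fun l (_ : l ∈ univ) => h2 l
    rw [Finset.sum_sub_distrib] at h3
    simp only [Finset.sum_const, Finset.card_univ, Fintype.card_fin, nsmul_eq_mul] at h3
    have h4 : (s : ℝ) * ((T.count H : ℝ) ^ 2 / 2) = 2 * (s * τ) := by rw [hτ]; ring
    linarith

/-- The total noise is large whenever `H` loses, whichever side it is on; a tie is decided for side
`0`, so the comparison of the estimates is weak in one case and strict in the other. -/
theorem le_sum_noise_sq_of_not_wins {n s k w : ℕ} (hs : 0 < s)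
    (h : (Fin w → Bool) → Fin n → Bool)
    (T : List (Fin n)) (H : Fin n) (y : Chunk s k w) (hy : ¬ Wins h T H y) :
    (k + 1) * (s * ((T.count H : ℝ) ^ 2 / 4)) ≤
      ∑ b, ∑ g, ∑ l, noise h T H y b g l ^ 2 := by
  have hp : pairBit h T y = decide (sideEstimate h T y 0 < sideEstimate h T y 1) := rfl
  rw [Wins, hp] at hy
  cases hB : hashBits h y H
  · rw [hB] at hy
    refine le_sum_noise_sq_of_estimate_le hs h T H y 0 1 (by simp [hB, side])
      (by simp [hB, side]) ?_
    have : sideEstimate h T y 0 < sideEstimate h T y 1 := by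
      by_contra hc; exact hy (by simp [hc])
    exact this.le
  · rw [hB] at hy
    refine le_sum_noise_sq_of_estimate_le hs h T H y 1 0 (by simp [hB, side])
      (by simp [hB, side]) ?_
    by_contra hc; exact hy (by simp [not_le.1 hc])

/-- A heavy item loses a round with probability at most `1 / 64`: Markov's inequality for the
total noise. -/
theorem expect_not_wins_le {n s k w : ℕ} (hs : 0 < s) {h : (Fin w → Bool) → Fin n → Bool}
    (hh : IsFourWise h) (T : List (Fin n)) (hT : T ≠ []) (H : Fin n)
    (hH : (32 : ℝ) ^ 2 * ∑ j ∈ univ.erase H, (T.count j : ℝ) ^ 2 ≤ (T.count H : ℝ) ^ 2) :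
    𝔼 y : Chunk s k w, ind (¬ Wins h T H y) ≤ 1 / 64 := by
  set F := ∑ j ∈ univ.erase H, (T.count j : ℝ) ^ 2 with hF
  have hs' : (0 : ℝ) < s := by exact_mod_cast hs
  -- the round is not empty, so `H` occurs in it
  have hpos : 0 < (T.count H : ℝ) ^ 2 := by
    by_contra hneg
    have h0 : (T.count H : ℝ) ^ 2 = 0 := le_antisymm (not_lt.1 hneg) (sq_nonneg _)
    have hF0 : F = 0 := by
      have : 0 ≤ F := Finset.sum_nonneg fun j _ => sq_nonneg _
      linarith
    obtain ⟨j, hj⟩ := List.exists_mem_of_ne_nil T hT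
    have hjc : T.count j ≠ 0 := (List.count_pos_iff.2 hj).ne'
    by_cases hjH : j = H
    · subst hjH
      exact hjc (by exact_mod_cast pow_eq_zero_iff two_ne_zero |>.1 h0)
    · have := (Finset.sum_eq_zero_iff_of_nonneg fun j _ => sq_nonneg _).1 hF0 j
        (Finset.mem_erase.2 ⟨hjH, Finset.mem_univ _⟩)
      exact hjc (by exact_mod_cast pow_eq_zero_iff two_ne_zero |>.1 this)
  set τ : ℝ := (k + 1) * (s * ((T.count H : ℝ) ^ 2 / 4)) with hτ
  have hτ0 : 0 < τ := by positivity
  have h1 : (𝔼 y : Chunk s k w, ind (¬ Wins h T H y)) * τ ≤ 2 * ((2 * k + 1) * (s * F)) := by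
    calc (𝔼 y : Chunk s k w, ind (¬ Wins h T H y)) * τ
        = 𝔼 y : Chunk s k w, ind (¬ Wins h T H y) * τ := Finset.expect_mul _ _ _
      _ ≤ 𝔼 y : Chunk s k w, ∑ b, ∑ g, ∑ l, noise h T H y b g l ^ 2 := by
          refine expect_mono fun y => ?_
          by_cases hy : Wins h T H y
          · rw [ind_false (not_not.2 hy), zero_mul]
            exact Finset.sum_nonneg fun b _ => Finset.sum_nonneg fun g _ =>
              Finset.sum_nonneg fun l _ => sq_nonneg _
          · rw [ind_true hy, one_mul]
            exact le_sum_noise_sq_of_not_wins hs h T H y hy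
      _ ≤ ∑ _b : Fin 2, ∑ _g : Fin (2 * k + 1), ∑ _l : Fin s, F := by
          simp_rw [Finset.expect_sum_comm]
          exact Finset.sum_le_sum fun b _ => Finset.sum_le_sum fun g _ =>
            Finset.sum_le_sum fun l _ => expect_noise_sq_le hh T H b g l
      _ = _ := by simp
  have h2 : 2 * ((2 * k + 1) * (s * F)) ≤ 1 / 64 * τ := by
    have h3 : (s : ℝ) * F ≤ s * (T.count H : ℝ) ^ 2 / 1024 := by
      rw [mul_div_assoc]
      exact mul_le_mul_of_nonneg_left (by linarith) hs'.le
    have h4 : 0 ≤ (s : ℝ) * (T.count H : ℝ) ^ 2 := by positivity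
    have h5 : 2 * ((2 * k + 1) * (s * F)) ≤
        2 * ((2 * k + 1) * ((s : ℝ) * (T.count H : ℝ) ^ 2 / 1024)) := by gcongr
    refine h5.trans ?_
    rw [hτ]
    nlinarith [mul_nonneg (Nat.cast_nonneg (α := ℝ) k) h4]
  exact le_of_mul_le_mul_right (h1.trans h2) hτ0

/-- An item other than a heavy one wins a round with probability at most `1 / 2 + 1 / 64`: its hash
bit agrees with that of the heavy item with probability one half. -/
theorem expect_wins_le {n s k w : ℕ} (hs : 0 < s) {h : (Fin w → Bool) → Fin n → Bool}
    (hh : IsFourWise h) (T : List (Fin n)) (hT : T ≠ []) (H : Fin n)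
    (hH : (32 : ℝ) ^ 2 * ∑ j ∈ univ.erase H, (T.count j : ℝ) ^ 2 ≤ (T.count H : ℝ) ^ 2)
    {j : Fin n} (hj : j ≠ H) :
    𝔼 y : Chunk s k w, ind (Wins h T j y) ≤ 33 / 64 := by
  have h1 : ∀ y : Chunk s k w, ind (Wins h T j y) ≤
      ind (hashBits h y j = hashBits h y H) + ind (¬ Wins h T H y) := by
    intro y
    refine (ind_mono fun hw => ?_).trans (ind_or_le _ _)
    by_cases hc : Wins h T H y
    · exact Or.inl (hw.trans hc.symm)
    · exact Or.inr hc
  have h2 : 𝔼 y : Chunk s k w, ind (hashBits h y j = hashBits h y H) = 1 / 2 := by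
    let o : Fin (numSeeds s k) := (0 : Fin (2 * ((2 * k + 1) * s) + 1))
    refine (expect_update_seed o fun f : Fin (numSeeds s k) → Fin w → Bool =>
      ind (h (f o) j = h (f o) H)).trans ?_
    simp only [Function.update_self]
    rw [Fintype.expect_const, hh.expect_eq hj]
  have h3 := expect_mono h1
  rw [Finset.expect_add_distrib, h2] at h3
  linarith [expect_not_wins_le (k := k) hs hh T hT H hH]

/-! ### All rounds with truly random bits -/

/-- The number of rounds with property `p`. -/
noncomputable def numRounds {R : ℕ} (p : Fin R → Prop) : ℕ :=
  open Classical in (univ.filter p).card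

theorem numRounds_add_not {R : ℕ} (p : Fin R → Prop) :
    numRounds p + numRounds (fun r => ¬ p r) = R := by
  classical
  have := Finset.card_filter_add_card_filter_not (s := (univ : Finset (Fin R))) p
  rw [Finset.card_univ, Fintype.card_fin] at this
  convert this using 2 <;> unfold numRounds <;> congr

theorem prod_eq_pow_numRounds {R : ℕ} (p : Fin R → Prop) (θ : ℝ) :
    ∏ r, (1 + (θ - 1) * ind (p r)) = θ ^ numRounds p := by
  classical
  rw [numRounds, ← Finset.prod_const, Finset.prod_filter]
  refine Finset.prod_congr rfl fun r _ => ?_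
  by_cases hr : p r <;> simp [ind, hr]

/-- A Chernoff bound for independent events of probability at most `p`: the probability that at
least `m R / 4` of the `R` events occur. The exponential moment is taken with base `μ ^ 4`, so that
the threshold becomes the natural power `μ ^ (m R)`. -/
theorem expect_ind_card_le {R : ℕ} {X : Type*} [Fintype X] [Nonempty X] (W : Fin R → X → Prop)
    (p μ : ℝ) (hμ : 1 ≤ μ) (m : ℕ)
    (hW : ∀ r, 𝔼 x, ind (W r x) ≤ p) :
    𝔼 y : Fin R → X, ind (m * R ≤ 4 * numRounds fun r => W r (y r)) ≤
      ((1 + (μ ^ 4 - 1) * p) / μ ^ m) ^ R := by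
  classical
  have hμ0 : 0 < μ := by linarith
  have hμ4 : 0 ≤ μ ^ 4 - 1 := by linarith [one_le_pow₀ hμ (n := 4)]
  rw [div_pow, le_div_iff₀ (by positivity), Finset.expect_mul]
  calc _ ≤ 𝔼 y : Fin R → X, ∏ r, (1 + (μ ^ 4 - 1) * ind (W r (y r))) := by
        refine expect_mono fun y => ?_
        rw [prod_eq_pow_numRounds, ← pow_mul]
        by_cases hc : m * R ≤ 4 * numRounds fun r => W r (y r)
        · rw [ind_true hc, one_mul, ← pow_mul]
          exact pow_le_pow_right₀ hμ hc
        · rw [ind_false hc, zero_mul]; positivity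
    _ = ∏ r, 𝔼 x, (1 + (μ ^ 4 - 1) * ind (W r x)) :=
        expect_prod_pi fun r x => 1 + (μ ^ 4 - 1) * ind (W r x)
    _ ≤ ∏ _r : Fin R, (1 + (μ ^ 4 - 1) * p) := by
        refine Finset.prod_le_prod (fun r _ => Finset.expect_nonneg fun x _ => ?_) fun r _ => ?_
        · exact add_nonneg zero_le_one (mul_nonneg hμ4 (ind_nonneg _))
        · rw [Finset.expect_add_distrib, Fintype.expect_const, ← Finset.mul_expect]
          exact add_le_add_right (mul_le_mul_of_nonneg_left (hW r) hμ4) _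
    _ = _ := by simp

theorem itemWins_eq {n s k w R : ℕ} (h : (Fin w → Bool) → Fin n → Bool) (S : List (Fin n))
    (q : Fin (R + 1) → ℕ) (y : Fin R → Chunk s k w) (j : Fin n) :
    itemWins h S q y j = numRounds fun r => Wins h (roundStream S q r) j (y r) := by
  unfold itemWins wins numRounds Wins sieve
  congr

theorem roundStream_ne_nil {n R : ℕ} {S : List (Fin n)} {q : Fin (R + 1) → ℕ}
    (hq : IsRoundTimes S q) (r : Fin R) : roundStream S q r ≠ [] := by
  have h1 : q r.castSucc < q r.succ := hq.1 Fin.castSucc_lt_succ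
  have h2 : q r.succ ≤ q (Fin.last R) := hq.1.monotone (Fin.le_last _)
  have h3 := hq.2
  rw [roundStream, interval, ← List.length_pos_iff, List.length_drop, List.length_take]
  omega

theorem auxBit_eq_true_iff {n s k w R : ℕ} (h : (Fin w → Bool) → Fin n → Bool) (S : List (Fin n))
    (q : Fin (R + 1) → ℕ) (j : Fin n) (y : Fin R → Chunk s k w) :
    auxBit h S q j y = true ↔ 3 * R < 4 * itemWins h S q y j := by
  rw [auxBit, decide_eq_true_iff, div_lt_iff₀ (by norm_num)]
  rw [← Nat.cast_lt (α := ℝ)]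
  push_cast
  rw [mul_comm (4 : ℝ)]

/-- An everywhere heavy item is rejected by its auxiliary algorithm with exponentially small
probability. -/
theorem expect_auxBit_heavy_le {n s k w R : ℕ} (hs : 0 < s)
    {h : (Fin w → Bool) → Fin n → Bool} (hh : IsFourWise h) {S : List (Fin n)}
    {q : Fin (R + 1) → ℕ} (hq : IsRoundTimes S q) {H : Fin n} (hH : EverywhereHeavy 32 S q H) :
    𝔼 y : Fin R → Chunk s k w, ind (¬ auxBit h S q H y = true) ≤ (23 / 25) ^ R := by
  classical
  -- at least a quarter of the rounds are lost; `(1 + 15 / 64) / 2 ≤ 23 / 25`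
  have hc := expect_ind_card_le (fun r (y : Chunk s k w) => ¬ Wins h (roundStream S q r) H y)
    (1 / 64) 2 (by norm_num) 1
    fun r => expect_not_wins_le hs hh _ (roundStream_ne_nil hq r) H (hH r)
  refine le_trans (expect_mono fun y => ind_mono fun hy => ?_)
    (hc.trans (pow_le_pow_left₀ (by norm_num) (by norm_num) R))
  rw [auxBit_eq_true_iff, itemWins_eq] at hy
  have := numRounds_add_not fun r => Wins h (roundStream S q r) H (y r)
  omega

/-- An item other than an everywhere heavy one is accepted by its auxiliary algorithm with
exponentially small probability. -/
theorem expect_auxBit_light_le {n s k w R : ℕ} (hs : 0 < s)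
    {h : (Fin w → Bool) → Fin n → Bool} (hh : IsFourWise h) {S : List (Fin n)}
    {q : Fin (R + 1) → ℕ} (hq : IsRoundTimes S q) {H : Fin n} (hH : EverywhereHeavy 32 S q H)
    {j : Fin n} (hj : j ≠ H) :
    𝔼 y : Fin R → Chunk s k w, ind (auxBit h S q j y = true) ≤ (23 / 25) ^ R := by
  classical
  -- at least three quarters of the rounds are won, and
  -- `(1 + 65 / 16 * (33 / 64)) / (27 / 8) ≤ 23 / 25`
  have hc := expect_ind_card_le (fun r (y : Chunk s k w) => Wins h (roundStream S q r) j y)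
    (33 / 64) (3 / 2) (by norm_num) 3
    fun r => expect_wins_le hs hh _ (roundStream_ne_nil hq r) H (hH r) hj
  refine le_trans (expect_mono fun y => ind_mono fun hy => ?_)
    (hc.trans (pow_le_pow_left₀ (by norm_num) (by norm_num) R))
  rw [auxBit_eq_true_iff, itemWins_eq] at hy
  omega

/-- Selector returns `H` as soon as `H` is the only item accepted by its auxiliary algorithm. -/
theorem sieveSelector_eq_of_auxBit {n s k w R : ℕ} (h : (Fin w → Bool) → Fin n → Bool)
    {sel : (Fin R → Fin n → Bool) → (Fin R → Bool) → Fin n} (hsel : IsSelector sel)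
    (S : List (Fin n)) (q : Fin (R + 1) → ℕ) (H : Fin n) (y : Fin R → Chunk s k w)
    (hH : auxBit h S q H y = true) (hj : ∀ j ≠ H, ¬ auxBit h S q j y = true) :
    sieveSelector h sel S q y = H := by
  by_contra hne
  refine hj _ hne ?_
  rw [auxBit_eq_true_iff] at hH ⊢
  have : itemWins h S q y H ≤ itemWins h S q y (sieveSelector h sel S q y) := hsel _ _ H
  omega

/-- The union bound over all items, for any distribution of the random bits. -/
theorem one_sub_le_expect_sieveSelector {α : Type*} [Fintype α] [Nonempty α] {n s k w R : ℕ}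
    (h : (Fin w → Bool) → Fin n → Bool)
    {sel : (Fin R → Fin n → Bool) → (Fin R → Bool) → Fin n} (hsel : IsSelector sel)
    (S : List (Fin n)) (q : Fin (R + 1) → ℕ) (H : Fin n) (Y : α → Fin R → Chunk s k w) (ε : ℝ)
    (hH : 𝔼 a, ind (¬ auxBit h S q H (Y a) = true) ≤ ε)
    (hj : ∀ j ≠ H, 𝔼 a, ind (auxBit h S q j (Y a) = true) ≤ ε) :
    1 - n * ε ≤ 𝔼 a, ind (sieveSelector h sel S q (Y a) = H) := by
  classical
  have hpt : ∀ a, 1 - ind (sieveSelector h sel S q (Y a) = H) ≤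
      ind (¬ auxBit h S q H (Y a) = true) +
        ∑ j ∈ univ.erase H, ind (auxBit h S q j (Y a) = true) := by
    intro a
    have h0 : 0 ≤ ∑ j ∈ univ.erase H, ind (auxBit h S q j (Y a) = true) :=
      Finset.sum_nonneg fun j _ => ind_nonneg _
    by_cases h1 : auxBit h S q H (Y a) = true
    · by_cases h2 : ∀ j ≠ H, ¬ auxBit h S q j (Y a) = true
      · rw [ind_true (sieveSelector_eq_of_auxBit h hsel S q H (Y a) h1 h2)]
        linarith [ind_nonneg (¬ auxBit h S q H (Y a) = true)]
      · push Not at h2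
        obtain ⟨j, hjH, hjt⟩ := h2
        have := Finset.single_le_sum (f := fun j => ind (auxBit h S q j (Y a) = true))
          (fun j _ => ind_nonneg _) (Finset.mem_erase.2 ⟨hjH, Finset.mem_univ j⟩)
        simp only [ind_true hjt] at this
        linarith [ind_nonneg (¬ auxBit h S q H (Y a) = true),
          ind_nonneg (sieveSelector h sel S q (Y a) = H)]
    · rw [ind_true h1]
      linarith [ind_nonneg (sieveSelector h sel S q (Y a) = H)]
  have h1 := expect_mono hpt
  rw [Finset.expect_sub_distrib, Fintype.expect_const, Finset.expect_add_distrib,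
    Finset.expect_sum_comm] at h1
  have h2 : ∑ j ∈ univ.erase H, 𝔼 a, ind (auxBit h S q j (Y a) = true) ≤
      ∑ _j ∈ univ.erase H, ε :=
    Finset.sum_le_sum fun j hjm => hj j (Finset.ne_of_mem_erase hjm)
  have h3 : ε + ∑ _j ∈ univ.erase H, ε = n * ε := by
    rw [add_comm, Finset.sum_erase_add _ _ (Finset.mem_univ H)]; simp
  linarith

/-! ### The one-pass implementation -/

/-- A machine with an arbitrary state space can be run in `W` bits on the inputs on which it only
visits a fixed set of at most `2 ^ W` states. -/
theorem exists_onePass {Seed In Out σ : Type} (init : Seed → σ) (step : Seed → σ → In → σ)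
    (out : Seed → σ → Out) (good : Finset σ) (hne : good.Nonempty) (W : ℕ)
    (hW : good.card ≤ 2 ^ W) :
    ∃ A : OnePass Seed In Out, A.work = W ∧ ∀ z l,
      (∀ l', l' <+: l → l'.foldl (step z) (init z) ∈ good) →
        A.run z l = out z (l.foldl (step z) (init z)) := by
  classical
  obtain ⟨f⟩ : Nonempty (good ↪ (Fin W → Bool)) :=
    Function.Embedding.nonempty_of_card_le (by simpa using hW)
  have : Nonempty good := hne.to_subtype
  let enc : σ → (Fin W → Bool) := fun x => if hx : x ∈ good then f ⟨x, hx⟩ else fun _ => false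
  let dec : (Fin W → Bool) → σ := fun y => (Function.invFun f y : good)
  have hdec : ∀ x ∈ good, dec (enc x) = x := by
    intro x hx
    simp only [dec, enc, hx, dif_pos]
    rw [Function.leftInverse_invFun f.injective]
  refine ⟨⟨W, fun z => enc (init z), fun z y i => enc (step z (dec y) i), fun z y => out z (dec y)⟩,
    rfl, fun z l hl => ?_⟩
  have key : ∀ l, (∀ l', l' <+: l → l'.foldl (step z) (init z) ∈ good) →
      l.foldl (fun y i => enc (step z (dec y) i)) (enc (init z)) =
        enc (l.foldl (step z) (init z)) := by
    intro l
    induction l using List.reverseRecOn with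
    | nil => intro _; rfl
    | append_singleton l i ih =>
      intro hl
      rw [List.foldl_append, List.foldl_append,
        ih fun l' hl' => hl l' (hl'.trans (List.prefix_append _ _))]
      simp only [List.foldl_cons, List.foldl_nil]
      rw [hdec _ (hl l (List.prefix_append _ _))]
  change out z (dec _) = _
  rw [key l hl, hdec _ (hl l (List.prefix_refl l))]

/-- The signed sum `∑ⱼ σⱼ fⱼ` of a stream. -/
noncomputable def linSum {n : ℕ} (σ : Fin n → Bool) (T : List (Fin n)) : ℝ :=
  ∑ j, sgn (σ j) * (T.count j : ℝ)

theorem linSum_nil {n : ℕ} (σ : Fin n → Bool) : linSum σ [] = 0 := by simp [linSum]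

theorem linSum_append_singleton {n : ℕ} (σ : Fin n → Bool) (T : List (Fin n)) (p : Fin n) :
    linSum σ (T ++ [p]) = linSum σ T + sgn (σ p) := by
  simp [linSum, List.count_append, List.count_singleton, mul_add, Finset.sum_add_distrib]

/-- The memory of the one-pass algorithm: the number of marks read so far, the signed sums of the
current round, and the winning bits of the finished rounds. -/
abbrev Memory (s k R : ℕ) : Type :=
  ℕ × (Fin 2 → Fin (2 * k + 1) → Fin s → ℤ) × (Fin R → Bool)

/-- The integer sign of a bit. -/
def sgnInt (b : Bool) : ℤ := if b then 1 else -1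

theorem cast_sgnInt (b : Bool) : ((sgnInt b : ℤ) : ℝ) = sgn b := by cases b <;> simp [sgnInt, sgn]

/-- The estimate on side `b` computed from the counters. -/
noncomputable def counterEstimate {s k : ℕ} (cnt : Fin 2 → Fin (2 * k + 1) → Fin s → ℤ)
    (b : Fin 2) : ℝ :=
  median fun g => (∑ l : Fin s, ((cnt b g l : ℤ) : ℝ) ^ 2) / (s : ℝ)

/-- One step of Sieve. A mark ends the current round, if any, and starts the next one; after `c`
marks the current round is number `c - 1`. Updates before the first mark and after the last one
are added to counters that are never used. -/
noncomputable def sieveStep {n s k w R : ℕ} (h : (Fin w → Bool) → Fin n → Bool)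
    (Y : ℕ → Chunk s k w) (M : Memory s k R) : Option (Fin n) → Memory s k R
  | none => (M.1 + 1, 0, fun r => if (r : ℕ) + 1 = M.1 then
      decide (counterEstimate M.2.1 0 < counterEstimate M.2.1 1) else M.2.2 r)
  | some p => (M.1, fun b g l => M.2.1 b g l + (if hashBits h (Y (M.1 - 1)) p = side b then
      sgnInt (signBits h (Y (M.1 - 1)) b g l p) else 0), M.2.2)

/-- The memory of Sieve after an input. -/
noncomputable def sieveFold {n s k w : ℕ} (R : ℕ) (h : (Fin w → Bool) → Fin n → Bool)
    (Y : ℕ → Chunk s k w) (l : List (Option (Fin n))) : Memory s k R :=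
  l.foldl (sieveStep h Y) (0, 0, fun _ => false)

theorem sieveFold_append_none {n s k w R : ℕ} (h : (Fin w → Bool) → Fin n → Bool)
    (Y : ℕ → Chunk s k w) (l : List (Option (Fin n))) :
    sieveFold R h Y (l ++ [none]) = sieveStep h Y (sieveFold R h Y l) none := by
  simp [sieveFold]

theorem sieveFold_append_some {n s k w R : ℕ} (h : (Fin w → Bool) → Fin n → Bool)
    (Y : ℕ → Chunk s k w) (l : List (Option (Fin n))) (p : Fin n) :
    sieveFold R h Y (l ++ [some p]) = sieveStep h Y (sieveFold R h Y l) (some p) := by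
  simp [sieveFold]

/-- The first component counts the marks read. -/
theorem sieveFold_fst {n s k w R : ℕ} (h : (Fin w → Bool) → Fin n → Bool)
    (Y : ℕ → Chunk s k w) (l : List (Option (Fin n))) :
    (sieveFold R h Y l).1 = l.count none := by
  induction l using List.reverseRecOn with
  | nil => rfl
  | append_singleton l i ih =>
    cases i with
    | none => rw [sieveFold_append_none, sieveStep, ih, List.count_append]; simp
    | some p => rw [sieveFold_append_some, sieveStep, ih, List.count_append]; simp

/-- A counter is bounded by the number of updates read. -/
theorem abs_sieveFold_le {n s k w R : ℕ} (h : (Fin w → Bool) → Fin n → Bool)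
    (Y : ℕ → Chunk s k w) (l : List (Option (Fin n))) (b : Fin 2) (g : Fin (2 * k + 1))
    (i : Fin s) : |(sieveFold R h Y l).2.1 b g i| ≤ l.reduceOption.length := by
  induction l using List.reverseRecOn with
  | nil => simp [sieveFold]
  | append_singleton l x ih =>
    cases x with
    | none => rw [sieveFold_append_none, sieveStep]; simp
    | some p =>
      rw [sieveFold_append_some, sieveStep, List.reduceOption_append]
      refine (abs_add_le _ _).trans ?_
      have : |if hashBits h (Y ((sieveFold R h Y l).1 - 1)) p = side b then
          sgnInt (signBits h (Y ((sieveFold R h Y l).1 - 1)) b g i p) else 0| ≤ 1 := by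
        split_ifs
        · unfold sgnInt; split_ifs <;> simp
        · simp
      simp only [List.reduceOption_singleton, List.length_append, Option.length_toList] at *
      push_cast
      simp
      linarith

/-- The part of the marked stream up to time `T`. -/
noncomputable def markedPrefix {n R : ℕ} (S : List (Fin n)) (q : Fin (R + 1) → ℕ) (T : ℕ) :
    List (Option (Fin n)) :=
  open Classical in
  (List.range T).flatMap fun t =>
    (if t ∈ Set.range q then [none] else []) ++ (S[t]?).toList.map some

theorem markedPrefix_succ {n R : ℕ} (S : List (Fin n)) (q : Fin (R + 1) → ℕ) (T : ℕ) :
    open Classical in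
    markedPrefix S q (T + 1) = (markedPrefix S q T ++ (if T ∈ Set.range q then [none] else [])) ++
      (S[T]?).toList.map some := by
  classical
  rw [markedPrefix, List.range_succ, List.flatMap_append, List.append_assoc]
  simp [markedPrefix]

theorem reduceOption_markedPrefix {n R : ℕ} (S : List (Fin n)) (q : Fin (R + 1) → ℕ) (T : ℕ) :
    (markedPrefix S q T).reduceOption = S.take T := by
  classical
  induction T with
  | zero => simp [markedPrefix]
  | succ T ih =>
    rw [markedPrefix_succ, List.reduceOption_append, List.reduceOption_append, ih,
      List.take_add_one]
    cases S[T]? <;> split_ifs <;> simp [List.reduceOption]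

theorem interval_succ {n : ℕ} (S : List (Fin n)) {t T : ℕ} (ht : t ≤ T) :
    interval S t (T + 1) = interval S t T ++ (S[T]?).toList := by
  rw [interval, interval, List.take_add_one]
  rcases le_total T S.length with hT | hT
  · rw [List.drop_append_of_le_length (by simp [List.length_take]; omega)]
  · rw [List.getElem?_eq_none hT]; simp

theorem interval_self {n : ℕ} (S : List (Fin n)) (t : ℕ) : interval S t t = [] := by
  rw [interval, List.drop_eq_nil_iff, List.length_take]; omega

/-- What the memory holds after the marks at times in `P` and the updates before time `T`. -/
structure SieveInv {n s k w R : ℕ} (h : (Fin w → Bool) → Fin n → Bool) (Y : ℕ → Chunk s k w)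
    (S : List (Fin n)) (q : Fin (R + 1) → ℕ) (P : ℕ → Prop) (T : ℕ) (M : Memory s k R) : Prop where
  le : M.1 ≤ R + 1
  marks : ∀ r : Fin (R + 1), P (q r) ↔ (r : ℕ) < M.1
  sums : ∀ r : Fin (R + 1), M.1 = r + 1 → ∀ b g l, ((M.2.1 b g l : ℤ) : ℝ) =
    linSum (signBits h (Y r) b g l) ((interval S (q r) T).filter
      fun j => hashBits h (Y r) j = side b)
  bits : ∀ r : Fin R, (r : ℕ) + 1 < M.1 → M.2.2 r = pairBit h (roundStream S q r) (Y r)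

/-- Just before time `T`, the memory reflects the marks and the updates before `T`. At a time with
a mark, the mark is read before the update, whence an intermediate state with the marks up to and
including `T`. -/
theorem sieveInv_markedPrefix {n s k w R : ℕ} (h : (Fin w → Bool) → Fin n → Bool)
    (Y : ℕ → Chunk s k w) (S : List (Fin n)) (q : Fin (R + 1) → ℕ) (hq : StrictMono q) (T : ℕ) :
    SieveInv h Y S q (· < T) T (sieveFold R h Y (markedPrefix S q T)) := by
  classical
  induction T with
  | zero =>
    refine ⟨by simp [sieveFold, markedPrefix], fun r => by simp [sieveFold, markedPrefix],
      fun r hr => by simp [sieveFold, markedPrefix] at hr,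
      fun r hr => by simp [sieveFold, markedPrefix] at hr⟩
  | succ T ih =>
    rw [markedPrefix_succ]
    -- first the mark at time `T`, if there is one
    have hmark : SieveInv h Y S q (· ≤ T) T (sieveFold R h Y
        (markedPrefix S q T ++ (if T ∈ Set.range q then [none] else []))) := by
      by_cases hT : T ∈ Set.range q
      · obtain ⟨r₀, rfl⟩ := hT
        rw [if_pos (Set.mem_range_self r₀), sieveFold_append_none]
        set M := sieveFold R h Y (markedPrefix S q (q r₀))
        have hM : M.1 = r₀ := by
          refine le_antisymm ?_ ?_
          · by_contra hlt
            exact lt_irrefl _ ((ih.marks r₀).2 (not_le.1 hlt))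
          · by_contra hlt
            have hlt' := not_le.1 hlt
            have := (ih.marks ⟨M.1, by omega⟩).1 (hq (Fin.lt_def.2 hlt'))
            exact lt_irrefl _ this
        refine ⟨?_, fun r => ?_, fun r hr b g l => ?_, fun r hr => ?_⟩
        · simp only [sieveStep, hM]; omega
        · simp only [sieveStep, hM, hq.le_iff_le, Fin.le_def]; omega
        · simp only [sieveStep, hM] at hr
          obtain rfl : r₀ = r := Fin.ext (by omega)
          simp [sieveStep, interval_self, linSum_nil]
        · simp only [sieveStep, hM] at hr ⊢
          by_cases hr' : (r : ℕ) + 1 = r₀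
          · rw [if_pos hr']
            have hsucc : r.succ = r₀ := Fin.ext (by simpa using hr')
            have hs := ih.sums r.castSucc (by rw [hM]; simpa using hr'.symm)
            have hest : ∀ b, counterEstimate M.2.1 b =
                sideEstimate h (roundStream S q r) (Y r) b := by
              intro b
              unfold counterEstimate
              simp only [hs, roundStream, hsucc]
              rfl
            rw [hest, hest]
            rfl
          · rw [if_neg hr']
            exact ih.bits r (by rw [hM]; omega)
      · rw [if_neg hT, List.append_nil]
        refine ⟨ih.le, fun r => ?_, ih.sums, ih.bits⟩
        rw [← ih.marks r]
        exact ⟨fun hle => lt_of_le_of_ne hle fun he => hT ⟨r, he⟩, le_of_lt⟩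
    -- then the update, if there is one
    revert hmark
    generalize markedPrefix S q T ++ (if T ∈ Set.range q then [none] else []) = L
    intro hmark
    have hlt : ∀ r, q r ≤ T ↔ q r < T + 1 := fun r => Nat.lt_succ_iff.symm
    cases hS : S[T]? with
    | none =>
      simp only [Option.toList_none, List.map_nil, List.append_nil]
      refine ⟨hmark.le, fun r => by rw [← hlt]; exact hmark.marks r, fun r hr b g l => ?_,
        hmark.bits⟩
      have hqr := (hmark.marks r).2 (by omega)
      rw [interval_succ S hqr, hS, hmark.sums r hr]
      simp
    | some p =>
      simp only [Option.toList_some, List.map_cons, List.map_nil]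
      rw [sieveFold_append_some]
      refine ⟨hmark.le, fun r => by rw [← hlt]; exact hmark.marks r, fun r hr b g l => ?_,
        hmark.bits⟩
      have hr' : (sieveFold R h Y L).1 = r + 1 := hr
      have hqr := (hmark.marks r).2 (by omega)
      simp only [sieveStep]
      rw [interval_succ S hqr, hS, List.filter_append, Int.cast_add, hmark.sums r hr', hr',
        Nat.add_sub_cancel]
      by_cases hp : hashBits h (Y r) p = side b
      · simp [hp, linSum_append_singleton, cast_sgnInt]
      · simp [hp]

theorem markedPrefix_length_succ {n R : ℕ} (S : List (Fin n)) (q : Fin (R + 1) → ℕ) :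
    markedPrefix S q (S.length + 1) = markedStream S q := rfl

/-- After the whole marked stream, the memory holds the output of Sieve. -/
theorem sieveFold_markedStream {n s k w R : ℕ} (h : (Fin w → Bool) → Fin n → Bool)
    (Y : ℕ → Chunk s k w) (S : List (Fin n)) (q : Fin (R + 1) → ℕ) (hq : IsRoundTimes S q) :
    (sieveFold R h Y (markedStream S q)).1 = R + 1 ∧
      (sieveFold R h Y (markedStream S q)).2.2 = sieve h S q fun r => Y r := by
  have hinv := sieveInv_markedPrefix h Y S q hq.1 (S.length + 1)
  rw [markedPrefix_length_succ] at hinv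
  have h1 : (sieveFold R h Y (markedStream S q)).1 = R + 1 := by
    have := (hinv.marks (Fin.last R)).1 (Nat.lt_succ_of_le hq.2)
    rw [Fin.val_last] at this
    exact le_antisymm hinv.le this
  exact ⟨h1, funext fun r => hinv.bits r (by rw [h1]; omega)⟩

/-- The contents of memory that occur on streams with at most `m` updates. -/
noncomputable def goodMemory (s k R m : ℕ) : Finset (Memory s k R) :=
  range (R + 2) ×ˢ (Fintype.piFinset fun _ => Fintype.piFinset fun _ => Fintype.piFinset fun _ =>
    Finset.Icc (-(m : ℤ)) m) ×ˢ univ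

theorem card_goodMemory (s k R m : ℕ) :
    (goodMemory s k R m).card =
      (R + 2) * ((2 * m + 1) ^ (2 * ((2 * k + 1) * s)) * 2 ^ R) := by
  have hI : (Finset.Icc (-(m : ℤ)) m).card = 2 * m + 1 := by
    rw [Int.card_Icc]; omega
  rw [goodMemory, Finset.card_product, Finset.card_product, Fintype.card_piFinset_const,
    Fintype.card_piFinset_const, Fintype.card_piFinset_const, hI, Finset.card_range,
    Finset.card_univ]
  simp only [Fintype.card_fin, Fintype.card_fun, Fintype.card_bool, ← pow_mul]
  congr 3
  ring

/-- Sieve followed by Selector as a one-pass algorithm. -/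
theorem exists_onePass_sieveSelector {Seed : Type} {n s k w R : ℕ}
    (h : (Fin w → Bool) → Fin n → Bool) (sel : (Fin R → Fin n → Bool) → (Fin R → Bool) → Fin n)
    (Y : Seed → ℕ → Chunk s k w) (m : ℕ) :
    ∃ A : OnePass Seed (Option (Fin n)) (Fin n),
      A.work = Nat.clog 2 ((R + 2) * ((2 * m + 1) ^ (2 * ((2 * k + 1) * s)) * 2 ^ R)) ∧
      ∀ (S : List (Fin n)) (q : Fin (R + 1) → ℕ), S.length ≤ m → IsRoundTimes S q → ∀ z,
        A.run z (markedStream S q) = sieveSelector h sel S q fun r => Y z r := by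
  have hmem : ∀ M : Memory s k R, M ∈ goodMemory s k R m ↔
      M.1 < R + 2 ∧ ∀ b g l, |M.2.1 b g l| ≤ m := by
    intro M
    simp [goodMemory, Fintype.mem_piFinset, abs_le]
  obtain ⟨A, hA, hrun⟩ := exists_onePass (fun _ : Seed => ((0, 0, fun _ => false) : Memory s k R))
    (fun z => sieveStep h (Y z)) (fun z M => sel (fun r => hashBits h (Y z r)) M.2.2)
    (goodMemory s k R m) ⟨(0, 0, fun _ => false), (hmem _).2 ⟨by simp, by simp⟩⟩ _
    (Nat.le_pow_clog (by norm_num) _)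
  refine ⟨A, by rw [hA, card_goodMemory], fun S q hS hq z => ?_⟩
  obtain ⟨h1, h2⟩ := sieveFold_markedStream h (Y z) S q hq
  rw [hrun z _ fun l' hl' => (hmem _).2 ⟨?_, fun b g l => ?_⟩]
  · change sel _ (sieveFold R h (Y z) (markedStream S q)).2.2 = _
    rw [h2]
    rfl
  · change (sieveFold R h (Y z) l').1 < _
    rw [sieveFold_fst] at h1 ⊢
    have := hl'.sublist.count_le none
    omega
  · refine (abs_sieveFold_le h (Y z) l' b g l).trans ?_
    have hle : l'.reduceOption.length ≤ S.length := by
      have := (hl'.sublist.filterMap id).length_le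
      refine this.trans ?_
      change (markedStream S q).reduceOption.length ≤ _
      rw [← markedPrefix_length_succ, reduceOption_markedPrefix, List.length_take]
      omega
    exact_mod_cast hle.trans hS

/-! ### Choice of parameters -/

theorem one_lt_log_three : 1 < Real.log 3 := by
  rw [Real.lt_log_iff_exp_lt (by norm_num)]
  have := Real.exp_one_lt_d9
  linarith

theorem loglog_three_pos : 0 < Real.log (Real.log 3) := Real.log_pos one_lt_log_three

theorem loglog_three_le {n : ℕ} (hn : 3 ≤ n) :
    Real.log (Real.log 3) ≤ Real.log (Real.log n) := by
  have h1 := one_lt_log_three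
  exact Real.log_le_log (by linarith) (Real.log_le_log (by norm_num) (by exact_mod_cast hn))

theorem log_le_of_pos {x : ℝ} (hx : 0 < x) : Real.log x ≤ x := by
  linarith [Real.log_le_sub_one_of_pos hx]

/-- The working memory is logarithmic. -/
theorem clog_card_goodMemory_le {n R P a : ℕ} (hn : 3 ≤ n) (D : ℕ) (hR : (R : ℝ) ≤ P * Real.log n) :
    (Nat.clog 2 ((R + 2) * ((2 * n ^ a + 1) ^ D * 2 ^ R)) : ℝ) ≤
      (4 * P + 5 + 2 * D * (1 + a)) * Real.log n := by
  have hl := one_le_log hn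
  have hn0 : (0 : ℝ) < n := by positivity
  have h1 := clog_two_le ((R + 2) * ((2 * n ^ a + 1) ^ D * 2 ^ R)) (Nat.one_le_iff_ne_zero.2
    (by positivity))
  have h2 : Real.log (((R + 2) * ((2 * n ^ a + 1) ^ D * 2 ^ R) : ℕ) : ℝ) =
      Real.log (R + 2) + (D * Real.log (2 * (n : ℝ) ^ a + 1) + R * Real.log 2) := by
    push_cast
    rw [Real.log_mul (by positivity) (by positivity), Real.log_mul (by positivity) (by positivity),
      Real.log_pow, Real.log_pow]
  have h3 : Real.log ((R : ℝ) + 2) ≤ R + 1 := by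
    have := Real.log_le_sub_one_of_pos (show (0 : ℝ) < R + 2 by positivity)
    linarith
  have h4 : Real.log (2 * (n : ℝ) ^ a + 1) ≤ (1 + a) * Real.log n := by
    have hpow : (1 : ℝ) ≤ (n : ℝ) ^ a := one_le_pow₀ (by exact_mod_cast (by omega : 1 ≤ n))
    have h3n : (3 : ℝ) ≤ n := by exact_mod_cast hn
    calc Real.log (2 * (n : ℝ) ^ a + 1) ≤ Real.log (n * (n : ℝ) ^ a) :=
          Real.log_le_log (by positivity) (by nlinarith)
      _ = (1 + a) * Real.log n := by
          rw [Real.log_mul (by positivity) (by positivity), Real.log_pow]; ring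
  have h5 : (R : ℝ) * Real.log 2 ≤ R :=
    mul_le_of_le_one_right (Nat.cast_nonneg R) (by linarith [Real.log_two_lt_d9])
  have h6 : (D : ℝ) * Real.log (2 * (n : ℝ) ^ a + 1) ≤ D * ((1 + a) * Real.log n) :=
    mul_le_mul_of_nonneg_left h4 (Nat.cast_nonneg D)
  rw [h2] at h1
  nlinarith

/-- The number of bits per block that the error bound asks for is logarithmic. -/
theorem clog_error_le {n : ℕ} (hn : 3 ≤ n) (P : ℕ) :
    (Nat.clog 2 (2 * (P + 1) ^ 3 * n ^ 6) : ℝ) ≤ (15 + 6 * P) * Real.log n := by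
  have hl := one_le_log hn
  have hn0 : (0 : ℝ) < n := by positivity
  have h1 := clog_two_le (2 * (P + 1) ^ 3 * n ^ 6) (Nat.one_le_iff_ne_zero.2 (by positivity))
  have h2 : Real.log ((2 * (P + 1) ^ 3 * n ^ 6 : ℕ) : ℝ) =
      Real.log 2 + 3 * Real.log (P + 1) + 6 * Real.log n := by
    push_cast
    rw [Real.log_mul (by positivity) (by positivity), Real.log_mul (by positivity) (by positivity),
      Real.log_pow, Real.log_pow]
    norm_num
  have h3 : Real.log ((P : ℝ) + 1) ≤ P := by
    have := Real.log_le_sub_one_of_pos (show (0 : ℝ) < P + 1 by positivity)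
    linarith
  have h4 := Real.log_two_lt_d9
  have h5 : (P : ℝ) ≤ P * Real.log n := le_mul_of_one_le_right (Nat.cast_nonneg P) hl
  rw [h2] at h1
  nlinarith

/-- The number of hash functions is doubly logarithmic. Since `log (log n)` is small for small `n`,
the constant terms are absorbed through `log (log n) ≥ log (log 3) > 0`. -/
theorem one_add_clog_rounds_le {n R P : ℕ} (hn : 3 ≤ n) (hR : (R : ℝ) ≤ P * Real.log n) :
    1 + 3 * (Nat.clog 2 R : ℝ) ≤
      ((4 + 6 * P) / Real.log (Real.log 3) + 6) * Real.log (Real.log n) := by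
  have hl := one_le_log hn
  have h0 := loglog_three_pos
  have hll := loglog_three_le hn
  have h1 : 1 + 3 * (Nat.clog 2 R : ℝ) ≤ 4 + 6 * P + 6 * Real.log (Real.log n) := by
    rcases Nat.eq_zero_or_pos R with rfl | hRpos
    · simp only [Nat.clog_zero_right, Nat.cast_zero]
      have : (0 : ℝ) ≤ P := Nat.cast_nonneg P
      linarith
    · have h2 := clog_two_le R hRpos
      have hR1 : (1 : ℝ) ≤ R := by exact_mod_cast hRpos
      have hP : 0 < (P : ℝ) := by
        by_contra hP
        nlinarith
      have h3 : Real.log R ≤ P + Real.log (Real.log n) := by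
        calc Real.log R ≤ Real.log (P * Real.log n) := Real.log_le_log (by linarith) hR
          _ = Real.log P + Real.log (Real.log n) :=
              Real.log_mul hP.ne' (by linarith)
          _ ≤ _ := by linarith [log_le_of_pos hP]
      linarith
  have h2 : (4 + 6 * (P : ℝ)) ≤ (4 + 6 * P) / Real.log (Real.log 3) * Real.log (Real.log n) := by
    rw [div_mul_eq_mul_div, le_div_iff₀ h0]
    exact mul_le_mul_of_nonneg_left hll (by positivity)
  linarith

/-- With these parameters the error of the generator is at most `1 / n ^ 3`. -/
theorem nisan_error_le {n R P : ℕ} (hn : 3 ≤ n) (hR : (R : ℝ) ≤ P * Real.log n) :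
    2 ^ Nat.clog 2 R * (((R : ℝ) + 1) ^ 2 *
      (1 / 2 : ℝ) ^ Nat.clog 2 (2 * (P + 1) ^ 3 * n ^ 6)) ≤ 1 / (n : ℝ) ^ 3 := by
  have hn0 : (0 : ℝ) < n := by positivity
  have hn1 : (1 : ℝ) ≤ n := by exact_mod_cast (by omega : 1 ≤ n)
  have hd : (2 : ℝ) ^ Nat.clog 2 R ≤ 2 * (R + 1) := by
    rcases Nat.lt_or_ge 1 R with h1 | h1
    · have hpos : 0 < Nat.clog 2 R := Nat.clog_pos (by norm_num) (by omega)
      have h2 := Nat.pow_pred_clog_lt_self (b := 2) (by norm_num) (x := R) (by omega)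
      have h3 : 2 ^ Nat.clog 2 R = 2 * 2 ^ (Nat.clog 2 R).pred := by
        rw [← pow_succ', Nat.pred_eq_sub_one, Nat.sub_add_cancel hpos]
      have h4 : (2 : ℝ) ^ Nat.clog 2 R = 2 * (2 : ℝ) ^ (Nat.clog 2 R).pred := by exact_mod_cast h3
      have h5 : (2 : ℝ) ^ (Nat.clog 2 R).pred ≤ R := by exact_mod_cast h2.le
      linarith
    · rw [Nat.clog_of_right_le_one h1]
      have : (0 : ℝ) ≤ R := Nat.cast_nonneg R
      norm_num; linarith
  have hR1 : (R : ℝ) + 1 ≤ (P + 1) * n := by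
    have h1 : (P : ℝ) * Real.log n ≤ P * n :=
      mul_le_mul_of_nonneg_left (log_le_of_pos hn0) (Nat.cast_nonneg P)
    linarith
  have hη : (1 / 2 : ℝ) ^ Nat.clog 2 (2 * (P + 1) ^ 3 * n ^ 6) ≤
      1 / (2 * (P + 1) ^ 3 * (n : ℝ) ^ 6) := by
    rw [one_div_pow]
    refine one_div_le_one_div_of_le (by positivity) ?_
    exact_mod_cast Nat.le_pow_clog (b := 2) (by norm_num) (2 * (P + 1) ^ 3 * n ^ 6)
  calc _ ≤ (2 * ((R : ℝ) + 1)) * (((R : ℝ) + 1) ^ 2 * (1 / (2 * (P + 1) ^ 3 * (n : ℝ) ^ 6))) := by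
        gcongr
    _ = ((R : ℝ) + 1) ^ 3 * (1 / ((P + 1) ^ 3 * (n : ℝ) ^ 6)) := by field_simp
    _ ≤ ((P + 1) * n) ^ 3 * (1 / ((P + 1) ^ 3 * (n : ℝ) ^ 6)) := by gcongr
    _ = 1 / (n : ℝ) ^ 3 := by field_simp

/-- The constant `40` in the number of rounds: `23 / 25 ≤ exp (-2 / 25)` and `40 * (2 / 25) ≥ 3`. -/
theorem pow_rounds_le {n R : ℕ} (hn : 3 ≤ n) (hR : 40 * Real.log n ≤ (R : ℝ)) :
    (23 / 25 : ℝ) ^ R ≤ 1 / (n : ℝ) ^ 3 := by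
  have hl := one_le_log hn
  have hn0 : (0 : ℝ) < n := by positivity
  have h1 : (23 / 25 : ℝ) ≤ Real.exp (-(2 / 25)) := by
    have := Real.add_one_le_exp (-(2 / 25 : ℝ))
    linarith
  calc (23 / 25 : ℝ) ^ R ≤ Real.exp (-(2 / 25)) ^ R := pow_le_pow_left₀ (by norm_num) h1 R
    _ = Real.exp (R * -(2 / 25)) := (Real.exp_nat_mul _ _).symm
    _ ≤ Real.exp (-Real.log ((n : ℝ) ^ 3)) := by
        rw [Real.exp_le_exp, Real.log_pow]; push_cast; linarith
    _ = 1 / (n : ℝ) ^ 3 := by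
        rw [Real.exp_neg, Real.exp_log (by positivity), one_div]

/-- If the generator fools the auxiliary algorithms of all items, then it changes the probability
that Selector returns an everywhere heavy item by at most `1 / n`: both probabilities are within
`1 / n` of one. -/
theorem abs_sieveSelector_sub_le {α : Type*} [Fintype α] [Nonempty α] {n s k w R : ℕ} (hn : 3 ≤ n)
    (hs : 0 < s) (hR : 40 * Real.log n ≤ (R : ℝ)) {h : (Fin w → Bool) → Fin n → Bool}
    (hh : IsFourWise h) {sel : (Fin R → Fin n → Bool) → (Fin R → Bool) → Fin n}
    (hsel : IsSelector sel) {S : List (Fin n)} {q : Fin (R + 1) → ℕ} (hq : IsRoundTimes S q)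
    {H : Fin n} (hH : EverywhereHeavy 32 S q H) (Y : α → Fin R → Chunk s k w)
    (hY : ∀ j, |unifPr (fun z => auxBit h S q j (Y z) = true) -
      unifPr (fun y : Fin R → Chunk s k w => auxBit h S q j y = true)| ≤ 1 / (n : ℝ) ^ 3) :
    |unifPr (fun z => sieveSelector h sel S q (Y z) = H) -
      unifPr (fun y : Fin R → Chunk s k w => sieveSelector h sel S q y = H)| ≤ 1 / (n : ℝ) := by
  have hn0 : (0 : ℝ) < n := by positivity
  have hpow := pow_rounds_le hn hR
  have heavy := (expect_auxBit_heavy_le (k := k) hs hh hq hH).trans hpow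
  have light : ∀ j ≠ H, _ := fun j hj => (expect_auxBit_light_le (k := k) hs hh hq hH hj).trans hpow
  simp only [unifPr_eq_expect] at hY ⊢
  have hU := one_sub_le_expect_sieveSelector h hsel S q H (fun y : Fin R → Chunk s k w => y)
    (2 / (n : ℝ) ^ 3) (heavy.trans (by gcongr; norm_num))
    fun j hj => (light j hj).trans (by gcongr; norm_num)
  have htwo : 2 / (n : ℝ) ^ 3 = 1 / (n : ℝ) ^ 3 + 1 / (n : ℝ) ^ 3 := by ring
  have hN := one_sub_le_expect_sieveSelector h hsel S q H Y (2 / (n : ℝ) ^ 3)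
    (by
      have h1 := abs_le.1 (hY H)
      simp only [ind_not, Finset.expect_sub_distrib, Fintype.expect_const] at heavy ⊢
      linarith)
    fun j hj => by
      have h1 := abs_le.1 (hY j)
      have h2 := light j hj
      linarith
  have hfail : (n : ℝ) * (2 / (n : ℝ) ^ 3) ≤ 1 / n := by
    have h3 : (3 : ℝ) ≤ n := by exact_mod_cast hn
    rw [mul_div_assoc', div_le_div_iff₀ (by positivity) hn0]
    nlinarith [mul_nonneg (sq_nonneg (n : ℝ)) (by linarith : (0 : ℝ) ≤ n - 2)]
  rw [abs_le]
  constructor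
  · linarith [expect_ind_le_one fun y : Fin R → Chunk s k w => sieveSelector h sel S q y = H]
  · linarith [expect_ind_le_one fun z => sieveSelector h sel S q (Y z) = H]

end CountSieve

theorem mainTheorem7 :
    -- four-wise independent bits can be generated from seeds of `O(log n)` bits
    (∃ c : ℝ, ∀ n : ℕ, 3 ≤ n → ∃ (w : ℕ) (h : (Fin w → Bool) → Fin n → Bool),
      (w : ℝ) ≤ c * Real.log n ∧ IsFourWise h) ∧
    ∃ (C ρ₀ : ℝ) (s₀ : ℕ), 0 < C ∧ 0 < ρ₀ ∧
      ∀ (a : ℕ) (c ρ : ℝ) (s k : ℕ), s₀ ≤ s →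
        ∃ K : ℝ, ∀ n : ℕ, 3 ≤ n → ∀ R w : ℕ, (R : ℝ) ≤ ρ * Real.log n → (w : ℝ) ≤ c * Real.log n →
          ∀ h : (Fin w → Bool) → Fin n → Bool, IsFourWise h →
            ∃ (v d : ℕ) (hv : chunkBits s k w ≤ v), R ≤ 2 ^ d ∧
              (nisanSeedLength v d : ℝ) ≤ K * (Real.log n * Real.log (Real.log n)) ∧
              -- the auxiliary algorithm of every item is fooled
              (∀ (S : List (Fin n)) (q : Fin (R + 1) → ℕ), IsRoundTimes S q → ∀ j : Fin n,
                |unifPr (fun z : NisanSeed v d => auxBit h S q j (nisanChunks hv R d z) = true) -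
                  unifPr (fun y : Fin R → Chunk s k w => auxBit h S q j y = true)|
                    ≤ 1 / (n : ℝ) ^ 2) ∧
              ∀ sel : (Fin R → Fin n → Bool) → (Fin R → Bool) → Fin n, IsSelector sel →
                -- one-pass implementation with the stored seed and `O(log n)` further bits
                (∃ A : OnePass (NisanSeed v d) (Option (Fin n)) (Fin n),
                  (A.work : ℝ) ≤ K * Real.log n ∧
                  ∀ (S : List (Fin n)) (q : Fin (R + 1) → ℕ), S.length ≤ n ^ a →
                    IsRoundTimes S q → ∀ z : NisanSeed v d,
                      A.run z (markedStream S q) =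
                        sieveSelector h sel S q (nisanChunks hv R d z)) ∧
                -- the success probability changes by at most `1 / n`
                (ρ₀ * Real.log n ≤ (R : ℝ) →
                  ∀ (S : List (Fin n)) (q : Fin (R + 1) → ℕ), IsRoundTimes S q →
                    ∀ H : Fin n, EverywhereHeavy C S q H →
                      |unifPr (fun z : NisanSeed v d =>
                          sieveSelector h sel S q (nisanChunks hv R d z) = H) -
                        unifPr (fun y : Fin R → Chunk s k w => sieveSelector h sel S q y = H)|
                          ≤ 1 / (n : ℝ)) := by
  refine ⟨⟨12, exists_isFourWise⟩, 32, 40, 1, by norm_num, by norm_num, fun a c ρ s k hs => ?_⟩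
  set P : ℕ := ⌈|ρ|⌉₊ with hP
  set D : ℕ := 2 * ((2 * k + 1) * s) with hD
  set V : ℝ := numSeeds s k * |c| + (30 + 12 * P) with hV
  set L : ℝ := (4 + 6 * P) / Real.log (Real.log 3) + 6 with hL
  set B : ℝ := 4 * P + 5 + 2 * D * (1 + a) with hB
  have hV0 : 0 ≤ V := by positivity
  have hL0 : 0 ≤ L := by
    have := loglog_three_pos
    positivity
  have hB0 : 0 ≤ B := by positivity
  refine ⟨V * L + B, fun n hn R w hR hw h hh => ?_⟩
  have hl := one_le_log hn
  have hll : 0 ≤ Real.log (Real.log n) := loglog_three_pos.le.trans (loglog_three_le hn)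
  have hRP : (R : ℝ) ≤ P * Real.log n :=
    hR.trans (mul_le_mul_of_nonneg_right ((le_abs_self ρ).trans (Nat.le_ceil _)) (by linarith))
  -- the mixing error is `2 ^ (-u)`, to be multiplied by `2 ^ d * (R + 1) ^ 2`, which is at most
  -- `2 * ((P + 1) * n) ^ 3`
  set u := Nat.clog 2 (2 * (P + 1) ^ 3 * n ^ 6) with hu
  set d := Nat.clog 2 R with hd
  have hcv : chunkBits s k w ≤ chunkBits s k w + 2 * u := Nat.le_add_right _ _
  have hRd : R ≤ 2 ^ d := Nat.le_pow_clog (by norm_num) R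
  have hη : (1 / 2 : ℝ) ^ (chunkBits s k w + 2 * u) ≤ ((1 / 2 : ℝ) ^ u) ^ 2 := by
    rw [← pow_mul]
    exact pow_le_pow_of_le_one (by norm_num) (by norm_num) (by omega)
  have hfool : ∀ (S : List (Fin n)) (q : Fin (R + 1) → ℕ) (j : Fin n),
      |unifPr (fun z : NisanSeed (chunkBits s k w + 2 * u) d =>
          auxBit h S q j (nisanChunks hcv R d z) = true) -
        unifPr (fun y : Fin R → Chunk s k w => auxBit h S q j y = true)| ≤ 1 / (n : ℝ) ^ 3 :=
    fun S q j => (auxBit_fooled (by positivity) hη hcv hRd h S q j).trans (nisan_error_le hn hRP)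
  refine ⟨chunkBits s k w + 2 * u, d, hcv, hRd, ?_, fun S q _ j => ?_, fun sel hsel => ⟨?_, ?_⟩⟩
  · have hv : ((chunkBits s k w + 2 * u : ℕ) : ℝ) ≤ V * Real.log n := by
      have h1 := clog_error_le hn P
      have h2 : (w : ℝ) ≤ |c| * Real.log n :=
        hw.trans (mul_le_mul_of_nonneg_right (le_abs_self c) (by linarith))
      have h3 : (numSeeds s k : ℝ) * w ≤ numSeeds s k * (|c| * Real.log n) :=
        mul_le_mul_of_nonneg_left h2 (Nat.cast_nonneg _)
      rw [chunkBits]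
      push_cast
      rw [hV]
      linarith
    have h1d : 1 + 3 * (d : ℝ) ≤ L * Real.log (Real.log n) := one_add_clog_rounds_le hn hRP
    calc (nisanSeedLength (chunkBits s k w + 2 * u) d : ℝ)
        = ((chunkBits s k w + 2 * u : ℕ) : ℝ) * (1 + 3 * d) := by
          rw [nisanSeedLength]; push_cast; ring
      _ ≤ (V * Real.log n) * (L * Real.log (Real.log n)) :=
          mul_le_mul hv h1d (by positivity) (by positivity)
      _ = V * L * (Real.log n * Real.log (Real.log n)) := by ring
      _ ≤ _ := mul_le_mul_of_nonneg_right (by linarith) (by positivity)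
  · refine (hfool S q j).trans (one_div_le_one_div_of_le (by positivity) ?_)
    exact pow_le_pow_right₀ (by exact_mod_cast (by omega : 1 ≤ n)) (by norm_num)
  · obtain ⟨A, hA, hrun⟩ := exists_onePass_sieveSelector h sel
      (fun (z : NisanSeed (chunkBits s k w + 2 * u) d) r (l : Fin (chunkBits s k w)) =>
        nisanBlock d z.2 z.1 r (Fin.castLE hcv l)) (n ^ a)
    refine ⟨A, ?_, fun S q hS hq z => hrun S q hS hq z⟩
    rw [hA]
    refine (clog_card_goodMemory_le hn D hRP).trans ?_
    exact mul_le_mul_of_nonneg_right (by linarith [mul_nonneg hV0 hL0]) (by linarith)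
  · intro hR40 S q hq H hH
    exact abs_sieveSelector_sub_le hn (by omega) hR40 hh hsel hq hH _ (hfool S q)
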